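/- Let $\mathcal H$ be the Hilbert space of one bosonic mode (a harmonic oscillator), with number (Fock) basis $|n\rangle=(n!)^{-1/2}(a^\dagger)^n|0\rangle$, $n\in\mathbb N=\{0,1,2,\dots\}$, where $a|n\rangle=\sqrt n\,|n-1\rangle$; concretely $\mathcal H=L^2(\mathbb R)$ with the Hermite basis, identified with $\ell^2(\mathbb N)$. A state is a positive semidefinite trace class operator of trace one. For $\nu\ge 0$ the thermal state is $$\tau_\nu=\frac1{\nu+1}\sum_{m=0}^\infty\Big(\frac{\nu}{\nu+1}\Big)^m|m\rangle\langle m|.$$ For $k\in\mathbb N$ consider $k$ signal modes $S_1,\dots,S_k$ with annihilation operators $a_1,\dots,a_k$ and an environment mode $E$ with annihilation operator $b$. For $\lambda\in(0,1)$ the beam splitter of transmissivity $\lambda$ between $S_l$ and $E$ is the unitary $$U_\lambda^{(S_lE)}=\exp\!\big[\arccos\sqrt\lambda\,\big(a_l^\dagger b-a_l b^\dagger\big)\big].$$ An environment state $\sigma$ is called $(\lambda,\sigma_0)$-achievable with $k$ trigger signals if there is a (possibly entangled) state $\rho$ of $S_1\cdots S_k$ such that $$\sigma=\operatorname{Tr}_{S_1\cdots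 S_k}\Big[U_\lambda^{(S_kE)}\cdots U_\lambda^{(S_1E)}\,(\rho\otimes\sigma_0)\,\big(U_\lambda^{(S_1E)}\big)^\dagger\cdots\big(U_\lambda^{(S_kE)}\big)^\dagger\Big],$$ and $(\lambda,\sigma_0)$-achievable if this holds for some $k\in\mathbb N$. **Theorem.** Let $n\in\mathbb N$, $\nu\ge0$ and $\lambda\in(0,1)$. The Fock state $|n\rangle\langle n|$ of the environment is $(\lambda,\tau_\nu)$-achievable if and only if $n=0$ and $\nu=0$. Moreover, if $n=\nu=0$, it is $(\lambda,\tau_\nu)$-achievable with $k$ trigger signals for every $k\in\mathbb N$. -/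

import Mathlib

open scoped InnerProductSpace ENNReal

noncomputable section

namespace Bosonic

/-! ### Number representation

A bosonic system whose number basis is indexed by `I` has the Hilbert space `ℓ²(I)`: `I = ℕ` for one
mode (the environment), `I = Fin k → ℕ` for `k` modes (the signals), and `I × J` for the Hilbert tensor
product of two systems, with `|i⟩ ⊗ |j⟩ = |(i, j)⟩`. -/

/-- The Hilbert space `ℓ²(I)` with orthonormal basis `|i⟩`, `i : I`. -/
abbrev NumberSpace (I : Type) : Type := lp (fun _ : I => ℂ) 2

/-- The bounded operators on `ℓ²(I)`. -/
abbrev Op (I : Type) : Type := NumberSpace I →L[ℂ] NumberSpace I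

/-- The number basis vector `|i⟩`. -/
def ket {I : Type} [DecidableEq I] (i : I) : NumberSpace I := lp.single 2 i (1 : ℂ)

theorem inner_ket {I : Type} [DecidableEq I] (i : I) (f : NumberSpace I) : ⟪ket i, f⟫_ℂ = f i := by
  simp [ket, lp.inner_single_left]

theorem ket_apply {I : Type} [DecidableEq I] (i j : I) : (ket i : NumberSpace I) j = if i = j then 1 else 0 := by
  by_cases h : i = j
  · subst h; simp [ket]
  · simp [ket, h, Ne.symm h]

theorem orthonormal_ket {I : Type} [DecidableEq I] : Orthonormal ℂ (ket : I → NumberSpace I) := by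
  rw [orthonormal_iff_ite]
  intro i j
  rw [inner_ket, ket_apply]
  simp [eq_comm]

/-- The isometry `ℓ²(I) → E` that sends `|i⟩` to `v i`, for an orthonormal family `v`. -/
def ofOrthonormal {I : Type} {E : Type*} [NormedAddCommGroup E] [InnerProductSpace ℂ E]
    [CompleteSpace E] {v : I → E} (hv : Orthonormal ℂ v) : NumberSpace I →ₗᵢ[ℂ] E :=
  hv.orthogonalFamily.linearIsometry

theorem ofOrthonormal_ket {I : Type} [DecidableEq I] {E : Type*} [NormedAddCommGroup E]
    [InnerProductSpace ℂ E] [CompleteSpace E] {v : I → E} (hv : Orthonormal ℂ v) (i : I) :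
    ofOrthonormal hv (ket i) = v i := by
  simp [ofOrthonormal, ket, OrthogonalFamily.linearIsometry_apply_single]

/-- A quantum state (density operator): positive semidefinite, with trace one. -/
def IsState {I : Type} [DecidableEq I] (ρ : Op I) : Prop :=
  ρ.IsPositive ∧ HasSum (fun i => ⟪ket i, ρ (ket i)⟫_ℂ) 1

/-! ### Tensor products of operators and partial trace -/

theorem orthonormal_inl {I J : Type} [DecidableEq I] [DecidableEq J] (j : J) :
    Orthonormal ℂ (fun i : I => (ket (i, j) : NumberSpace (I × J))) :=
  orthonormal_ket.comp (fun i : I => (i, j)) (fun _ _ h => congrArg Prod.fst h)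

theorem orthonormal_inr {I J : Type} [DecidableEq I] [DecidableEq J] (i : I) :
    Orthonormal ℂ (fun j : J => (ket (i, j) : NumberSpace (I × J))) :=
  orthonormal_ket.comp (fun j : J => (i, j)) (fun _ _ h => congrArg Prod.snd h)

/-- The isometry `x ↦ x ⊗ |j⟩`. -/
def tensorKet {I J : Type} [DecidableEq I] [DecidableEq J] (j : J) : NumberSpace I →ₗᵢ[ℂ] NumberSpace (I × J) :=
  ofOrthonormal (orthonormal_inl j)

/-- The isometry `y ↦ |i⟩ ⊗ y`. -/
def ketTensor {I J : Type} [DecidableEq I] [DecidableEq J] (i : I) : NumberSpace J →ₗᵢ[ℂ] NumberSpace (I × J) :=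
  ofOrthonormal (orthonormal_inr i)

theorem hasSum_ket {I : Type} [DecidableEq I] (x : NumberSpace I) : HasSum (fun i => x i • ket i) x := by
  simpa [ket, ← lp.single_smul] using lp.hasSum_single (p := 2) (by simp) x

theorem tensorKet_apply {I J : Type} [DecidableEq I] [DecidableEq J] (j : J) (x : NumberSpace I)
    (p : I × J) : tensorKet j x p = if p.2 = j then x p.1 else 0 := by
  have h := ((hasSum_ket x).mapL (tensorKet (J := J) j).toContinuousLinearMap).mapL
    (innerSL ℂ (ket p))
  simp only [map_smul, LinearIsometry.coe_toContinuousLinearMap, tensorKet, ofOrthonormal_ket] at h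
  rw [← tensorKet] at h
  simp only [innerSL_apply_apply, inner_ket, ket_apply] at h
  refine h.unique ?_
  convert! hasSum_ite_eq p.1 (if p.2 = j then x p.1 else 0) using 2 with i
  obtain ⟨a, b⟩ := p
  by_cases h1 : i = a <;> by_cases h2 : b = j <;> simp [h1, h2, eq_comm (a := j)]

theorem ketTensor_apply {I J : Type} [DecidableEq I] [DecidableEq J] (i : I) (y : NumberSpace J)
    (p : I × J) : ketTensor i y p = if p.1 = i then y p.2 else 0 := by
  have h := ((hasSum_ket y).mapL (ketTensor (J := J) i).toContinuousLinearMap).mapL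
    (innerSL ℂ (ket p))
  simp only [map_smul, LinearIsometry.coe_toContinuousLinearMap, ketTensor, ofOrthonormal_ket] at h
  rw [← ketTensor] at h
  simp only [innerSL_apply_apply, inner_ket, ket_apply] at h
  refine h.unique ?_
  convert! hasSum_ite_eq p.2 (if p.1 = i then y p.2 else 0) using 2 with j
  obtain ⟨a, b⟩ := p
  by_cases h1 : a = i <;> by_cases h2 : j = b <;> simp [h1, h2, eq_comm (a := i)]

theorem orthogonalFamily_tensorKet {I J : Type} [DecidableEq I] [DecidableEq J] :
    OrthogonalFamily ℂ (fun _ : J => NumberSpace I) (fun j => (tensorKet j : NumberSpace I →ₗᵢ[ℂ] NumberSpace (I × J))) := by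
  intro j j' hj x y
  rw [lp.inner_eq_tsum]
  refine (tsum_congr fun p => ?_).trans tsum_zero
  rw [tensorKet_apply, tensorKet_apply]
  by_cases h : p.2 = j
  · simp [h, hj]
  · simp [h]

theorem orthogonalFamily_ketTensor {I J : Type} [DecidableEq I] [DecidableEq J] :
    OrthogonalFamily ℂ (fun _ : I => NumberSpace J) (fun i => (ketTensor i : NumberSpace J →ₗᵢ[ℂ] NumberSpace (I × J))) := by
  intro i i' hi x y
  rw [lp.inner_eq_tsum]
  refine (tsum_congr fun p => ?_).trans tsum_zero
  rw [ketTensor_apply, ketTensor_apply]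
  by_cases h : p.1 = i
  · simp [h, hi]
  · simp [h]

/-- `⨁ⱼ ℓ²(I) → ℓ²(I × J)`, `(xⱼ)ⱼ ↦ ∑ⱼ xⱼ ⊗ |j⟩`. -/
def glueLeft (I J : Type) [DecidableEq I] [DecidableEq J] :
    lp (fun _ : J => NumberSpace I) 2 →ₗᵢ[ℂ] NumberSpace (I × J) :=
  orthogonalFamily_tensorKet.linearIsometry

/-- `⨁ᵢ ℓ²(J) → ℓ²(I × J)`, `(yᵢ)ᵢ ↦ ∑ᵢ |i⟩ ⊗ yᵢ`. -/
def glueRight (I J : Type) [DecidableEq I] [DecidableEq J] :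
    lp (fun _ : I => NumberSpace J) 2 →ₗᵢ[ℂ] NumberSpace (I × J) :=
  orthogonalFamily_ketTensor.linearIsometry

/-- The operator `A ⊗ 𝟙`. -/
def ampLeft {I J : Type} [DecidableEq I] [DecidableEq J] (A : Op I) : Op (I × J) :=
  (glueLeft I J).toContinuousLinearMap ∘L
    lp.mapCLM 2 (fun _ : J => A) (norm_nonneg A) (fun _ => le_rfl) ∘L
      ContinuousLinearMap.adjoint (glueLeft I J).toContinuousLinearMap

/-- The operator `𝟙 ⊗ B`. -/
def ampRight {I J : Type} [DecidableEq I] [DecidableEq J] (B : Op J) : Op (I × J) :=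
  (glueRight I J).toContinuousLinearMap ∘L
    lp.mapCLM 2 (fun _ : I => B) (norm_nonneg B) (fun _ => le_rfl) ∘L
      ContinuousLinearMap.adjoint (glueRight I J).toContinuousLinearMap

/-- The operator `A ⊗ B`. -/
def tensorOp {I J : Type} [DecidableEq I] [DecidableEq J] (A : Op I) (B : Op J) : Op (I × J) :=
  ampLeft A ∘L ampRight B

theorem ampLeft_ket {I J : Type} [DecidableEq I] [DecidableEq J] (A : Op I) (i : I) (j : J) :
    ampLeft A (ket (i, j)) = tensorKet j (A (ket i)) := by
  have h1 : glueLeft I J (lp.single 2 j (ket i)) = ket (i, j) := by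
    simp [glueLeft, OrthogonalFamily.linearIsometry_apply_single, tensorKet, ofOrthonormal_ket]
  have h2 : ContinuousLinearMap.adjoint (glueLeft I J).toContinuousLinearMap (ket (i, j))
      = lp.single 2 j (ket i) := by
    rw [← h1]
    exact congrArg (fun T => T (lp.single 2 j (ket i)))
      ((glueLeft I J).toContinuousLinearMap.norm_map_iff_adjoint_comp_self.1
        (fun x => (glueLeft I J).norm_map x))
  have h3 : lp.mapCLM 2 (fun _ : J => A) (norm_nonneg A) (fun _ => le_rfl) (lp.single 2 j (ket i))
      = lp.single 2 j (A (ket i)) := by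
    ext1
    funext j'
    by_cases hj : j' = j
    · subst hj; simp
    · simp [hj]
  simp only [ampLeft, ContinuousLinearMap.comp_apply, h2, h3]
  simp [glueLeft, OrthogonalFamily.linearIsometry_apply_single]

theorem ampRight_ket {I J : Type} [DecidableEq I] [DecidableEq J] (B : Op J) (i : I) (j : J) :
    ampRight B (ket (i, j)) = ketTensor i (B (ket j)) := by
  have h1 : glueRight I J (lp.single 2 i (ket j)) = ket (i, j) := by
    simp [glueRight, OrthogonalFamily.linearIsometry_apply_single, ketTensor, ofOrthonormal_ket]
  have h2 : ContinuousLinearMap.adjoint (glueRight I J).toContinuousLinearMap (ket (i, j))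
      = lp.single 2 i (ket j) := by
    rw [← h1]
    exact congrArg (fun T => T (lp.single 2 i (ket j)))
      ((glueRight I J).toContinuousLinearMap.norm_map_iff_adjoint_comp_self.1
        (fun x => (glueRight I J).norm_map x))
  have h3 : lp.mapCLM 2 (fun _ : I => B) (norm_nonneg B) (fun _ => le_rfl) (lp.single 2 i (ket j))
      = lp.single 2 i (B (ket j)) := by
    ext1
    funext i'
    by_cases hi : i' = i
    · subst hi; simp
    · simp [hi]
  simp only [ampRight, ContinuousLinearMap.comp_apply, h2, h3]
  simp [glueRight, OrthogonalFamily.linearIsometry_apply_single]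

/-- The matrix of `A ⊗ B` is the product of the matrices of `A` and `B`. -/
theorem tensorOp_ket_apply {I J : Type} [DecidableEq I] [DecidableEq J] (A : Op I) (B : Op J)
    (i : I) (j : J) (p : I × J) :
    tensorOp A B (ket (i, j)) p = A (ket i) p.1 * B (ket j) p.2 := by
  have h := (((hasSum_ket (B (ket j))).mapL (ketTensor (I := I) i).toContinuousLinearMap).mapL
    (ampLeft A)).mapL (innerSL ℂ (ket p))
  simp only [map_smul, LinearIsometry.coe_toContinuousLinearMap, ketTensor, ofOrthonormal_ket,
    ampLeft_ket] at h
  rw [← ketTensor, ← ampRight_ket] at h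
  simp only [innerSL_apply_apply, inner_ket, tensorKet_apply] at h
  refine h.unique ?_
  convert! hasSum_ite_eq p.2 (A (ket i) p.1 * B (ket j) p.2) using 2 with j'
  by_cases h1 : p.2 = j'
  · subst h1; simp [mul_comm]
  · simp [h1, Ne.symm h1]

/-- The partial trace over the first factor, `Tr_I T = ∑ᵢ (⟨i| ⊗ 𝟙) T (|i⟩ ⊗ 𝟙)`. The series converges in
operator norm for every trace class `T`. -/
def partialTrace {I J : Type} [DecidableEq I] [DecidableEq J] (T : Op (I × J)) : Op J :=
  ∑' i : I, ContinuousLinearMap.adjoint (ketTensor i).toContinuousLinearMap ∘L T ∘L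
    (ketTensor i).toContinuousLinearMap

/-! ### Fock states and thermal states -/

/-- A finite linear combination of number basis vectors, as a vector of `ℓ²(I)`. -/
def embed (I : Type) [DecidableEq I] : (I →₀ ℂ) →ₗ[ℂ] NumberSpace I := Finsupp.linearCombination ℂ ket

/-- The creation operator of one mode, `a† |n⟩ = √(n+1) |n+1⟩`, on finite combinations of number vectors. -/
def creation : (ℕ →₀ ℂ) →ₗ[ℂ] (ℕ →₀ ℂ) :=
  Finsupp.linearCombination ℂ fun n => Finsupp.single (n + 1) (Real.sqrt (n + 1) : ℂ)

/-- The Fock vector `(n!)^{-1/2} (a†)ⁿ |0⟩`. -/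
def fockVector (n : ℕ) : NumberSpace ℕ :=
  ((Real.sqrt n.factorial : ℂ))⁻¹ • embed ℕ ((creation ^ n) (Finsupp.single 0 1))

/-- The Fock state `|n⟩⟨n|`. -/
def fockState (n : ℕ) : Op ℕ := InnerProductSpace.rankOne ℂ (fockVector n) (fockVector n)

theorem creation_pow (n : ℕ) :
    (creation ^ n) (Finsupp.single 0 1) = Finsupp.single n (Real.sqrt n.factorial : ℂ) := by
  induction n with
  | zero => simp
  | succ n ih =>
    rw [pow_succ', Module.End.mul_apply, ih, creation, Finsupp.linearCombination_single,
      Finsupp.smul_single, smul_eq_mul, Nat.factorial_succ, mul_comm (n + 1)]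
    push_cast
    rw [Real.sqrt_mul (by positivity)]
    push_cast
    rfl

/-- The Fock vectors are the number basis vectors. -/
theorem fockVector_eq_ket (n : ℕ) : fockVector n = ket n := by
  have h : (Real.sqrt n.factorial : ℂ) ≠ 0 := by
    exact_mod_cast (Real.sqrt_pos.2 (by exact_mod_cast n.factorial_pos)).ne'
  rw [fockVector, creation_pow, embed, Finsupp.linearCombination_single, smul_smul,
    inv_mul_cancel₀ h, one_smul]

/-- The thermal state `τ_ν = (ν+1)⁻¹ ∑ₙ (ν/(ν+1))ⁿ |n⟩⟨n|` of mean photon number `ν`. -/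
def thermalState (ν : ℝ) : Op ℕ :=
  ((1 / (ν + 1) : ℝ) : ℂ) • ∑' n : ℕ, (((ν / (ν + 1)) ^ n : ℝ) : ℂ) • fockState n

/-! ### Beam splitters

Number basis vectors of `k` signals and the environment are indexed by `p = (m, n)` where `m l` is the
photon number of signal `l` and `n` that of the environment. -/

/-- Index set of the number basis of `k` signals and the environment. -/
abbrev Joint (k : ℕ) : Type := (Fin k → ℕ) × ℕ

/-- The annihilation operator `a_l` of signal `l`. -/
def aLower {k : ℕ} (l : Fin k) : (Joint k →₀ ℂ) →ₗ[ℂ] (Joint k →₀ ℂ) :=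
  Finsupp.linearCombination ℂ fun p =>
    Finsupp.single (Function.update p.1 l (p.1 l - 1), p.2) (Real.sqrt (p.1 l) : ℂ)

/-- The creation operator `a_l†` of signal `l`. -/
def aRaise {k : ℕ} (l : Fin k) : (Joint k →₀ ℂ) →ₗ[ℂ] (Joint k →₀ ℂ) :=
  Finsupp.linearCombination ℂ fun p =>
    Finsupp.single (Function.update p.1 l (p.1 l + 1), p.2) (Real.sqrt (p.1 l + 1) : ℂ)

/-- The annihilation operator `b` of the environment. -/
def bLower {k : ℕ} : (Joint k →₀ ℂ) →ₗ[ℂ] (Joint k →₀ ℂ) :=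
  Finsupp.linearCombination ℂ fun p => Finsupp.single (p.1, p.2 - 1) (Real.sqrt p.2 : ℂ)

/-- The creation operator `b†` of the environment. -/
def bRaise {k : ℕ} : (Joint k →₀ ℂ) →ₗ[ℂ] (Joint k →₀ ℂ) :=
  Finsupp.linearCombination ℂ fun p => Finsupp.single (p.1, p.2 + 1) (Real.sqrt (p.2 + 1) : ℂ)

/-- The generator `a_l† b - a_l b†`. -/
def bsGenerator {k : ℕ} (l : Fin k) : (Joint k →₀ ℂ) →ₗ[ℂ] (Joint k →₀ ℂ) :=
  aRaise l ∘ₗ bLower - aLower l ∘ₗ bRaise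

theorem embed_single {I : Type} [DecidableEq I] (i : I) (c : ℂ) :
    embed I (Finsupp.single i c) = c • ket i := by
  simp [embed]

theorem embed_injective (I : Type) [DecidableEq I] : Function.Injective (embed I) :=
  orthonormal_ket.linearIndependent

theorem inner_aLower {k : ℕ} (l : Fin k) (u v : Joint k →₀ ℂ) :
    ⟪embed _ (aLower l u), embed _ v⟫_ℂ = ⟪embed _ u, embed _ (aRaise l v)⟫_ℂ := by
  induction u using Finsupp.induction_linear with
  | zero => simp
  | add u₁ u₂ h₁ h₂ => simp only [map_add, inner_add_left, h₁, h₂]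
  | single p c =>
    induction v using Finsupp.induction_linear with
    | zero => simp
    | add u₁ u₂ h₁ h₂ => simp only [map_add, inner_add_right, h₁, h₂]
    | single q d =>
      obtain ⟨m, n⟩ := p
      obtain ⟨m', n'⟩ := q
      simp only [aLower, aRaise, Finsupp.linearCombination_single, map_smul, embed_single,
        inner_smul_left, inner_smul_right, inner_ket, ket_apply, Prod.mk.injEq]
      by_cases hm : m l = 0
      · have h2 : ¬ (Function.update m' l (m' l + 1) = m ∧ n' = n) := by
          rintro ⟨h, -⟩
          have := congrFun h l
          simp [hm] at this
        simp [hm, h2]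
      · by_cases h : m' = Function.update m l (m l - 1) ∧ n' = n
        · obtain ⟨rfl, rfl⟩ := h
          have h3 : ((m l - 1 : ℕ) : ℝ) + 1 = m l := by
            exact_mod_cast Nat.sub_add_cancel (Nat.pos_of_ne_zero hm)
          have h4 : m l - 1 + 1 = m l := Nat.sub_add_cancel (Nat.pos_of_ne_zero hm)
          simp [h3, h4, mul_comm]
        · have h2 : ¬ (Function.update m' l (m' l + 1) = m ∧ n' = n) := by
            rintro ⟨rfl, rfl⟩
            simp at h
          simp [h, h2]

theorem inner_bLower {k : ℕ} (u v : Joint k →₀ ℂ) :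
    ⟪embed _ (bLower u), embed _ v⟫_ℂ = ⟪embed _ u, embed _ (bRaise v)⟫_ℂ := by
  induction u using Finsupp.induction_linear with
  | zero => simp
  | add u₁ u₂ h₁ h₂ => simp only [map_add, inner_add_left, h₁, h₂]
  | single p c =>
    induction v using Finsupp.induction_linear with
    | zero => simp
    | add u₁ u₂ h₁ h₂ => simp only [map_add, inner_add_right, h₁, h₂]
    | single q d =>
      obtain ⟨m, n⟩ := p
      obtain ⟨m', n'⟩ := q
      simp only [bLower, bRaise, Finsupp.linearCombination_single, map_smul, embed_single,
        inner_smul_left, inner_smul_right, inner_ket, ket_apply, Prod.mk.injEq]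
      by_cases hn : n = 0
      · simp [hn]
      · by_cases h : m' = m ∧ n' = n - 1
        · obtain ⟨rfl, rfl⟩ := h
          have h3 : ((n - 1 : ℕ) : ℝ) + 1 = n := by
            exact_mod_cast Nat.sub_add_cancel (Nat.pos_of_ne_zero hn)
          have h4 : n - 1 + 1 = n := Nat.sub_add_cancel (Nat.pos_of_ne_zero hn)
          simp [h3, h4, mul_comm]
        · have h2 : ¬ (m' = m ∧ n' + 1 = n) := by
            rintro ⟨rfl, rfl⟩
            simp at h
          simp [h, h2]

theorem inner_aRaise {k : ℕ} (l : Fin k) (u v : Joint k →₀ ℂ) :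
    ⟪embed _ (aRaise l u), embed _ v⟫_ℂ = ⟪embed _ u, embed _ (aLower l v)⟫_ℂ := by
  rw [← inner_conj_symm, ← inner_aLower, inner_conj_symm]

theorem inner_bRaise {k : ℕ} (u v : Joint k →₀ ℂ) :
    ⟪embed _ (bRaise u), embed _ v⟫_ℂ = ⟪embed _ u, embed _ (bLower v)⟫_ℂ := by
  rw [← inner_conj_symm, ← inner_bLower, inner_conj_symm]

theorem aRaise_bLower {k : ℕ} (l : Fin k) (u : Joint k →₀ ℂ) :
    aRaise l (bLower u) = bLower (aRaise l u) := by
  induction u using Finsupp.induction_linear with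
  | zero => simp
  | add u₁ u₂ h₁ h₂ => simp only [map_add, h₁, h₂]
  | single p c =>
    simp only [aRaise, bLower, Finsupp.linearCombination_single, Finsupp.smul_single, smul_eq_mul]
    congr 1
    ring

theorem aLower_bRaise {k : ℕ} (l : Fin k) (u : Joint k →₀ ℂ) :
    aLower l (bRaise u) = bRaise (aLower l u) := by
  induction u using Finsupp.induction_linear with
  | zero => simp
  | add u₁ u₂ h₁ h₂ => simp only [map_add, h₁, h₂]
  | single p c =>
    simp only [aLower, bRaise, Finsupp.linearCombination_single, Finsupp.smul_single, smul_eq_mul]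
    congr 1
    ring

/-- The generator is skew-symmetric. -/
theorem inner_bsGenerator {k : ℕ} (l : Fin k) (u v : Joint k →₀ ℂ) :
    ⟪embed _ (bsGenerator l u), embed _ v⟫_ℂ = -⟪embed _ u, embed _ (bsGenerator l v)⟫_ℂ := by
  have h1 : ⟪embed _ (aRaise l (bLower u)), embed _ v⟫_ℂ
      = ⟪embed _ u, embed _ (aLower l (bRaise v))⟫_ℂ := by
    rw [inner_aRaise, inner_bLower, aLower_bRaise]
  have h2 : ⟪embed _ (aLower l (bRaise u)), embed _ v⟫_ℂ
      = ⟪embed _ u, embed _ (aRaise l (bLower v))⟫_ℂ := by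
    rw [inner_aLower, inner_bRaise, aRaise_bLower]
  simp only [bsGenerator, LinearMap.sub_apply, LinearMap.comp_apply, map_sub, inner_sub_left,
    inner_sub_right, h1, h2]
  ring

/-- Finite combinations of number vectors with at most `N` photons in total. -/
def upTo (k N : ℕ) : Submodule ℂ (Joint k →₀ ℂ) :=
  Finsupp.supported ℂ ℂ {p | ∑ i, p.1 i + p.2 ≤ N}

instance (k N : ℕ) : Module.Finite ℂ (upTo k N) := by
  have hfin : Set.Finite {p : Joint k | ∑ i, p.1 i + p.2 ≤ N} := by
    refine ((Set.finite_Iic (fun _ : Fin k => N)).prod (Set.finite_Iic N)).subset ?_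
    intro p hp
    have hp' : ∑ i, p.1 i + p.2 ≤ N := hp
    refine ⟨fun i => ?_, show p.2 ≤ N by omega⟩
    have := Finset.single_le_sum (f := p.1) (fun j _ => Nat.zero_le _) (Finset.mem_univ i)
    show p.1 i ≤ N
    omega
  have := hfin.to_subtype
  exact Module.Finite.equiv (Finsupp.supportedEquivFinsupp {p : Joint k | ∑ i, p.1 i + p.2 ≤ N}).symm

theorem sum_update_add {k : ℕ} (m : Fin k → ℕ) (l : Fin k) (x : ℕ) :
    ∑ i, Function.update m l x i + m l = ∑ i, m i + x := by
  rw [Finset.sum_update_of_mem (Finset.mem_univ l), ← Finset.add_sum_erase _ _ (Finset.mem_univ l),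
    Finset.sdiff_singleton_eq_erase]
  ring

theorem bsGenerator_mem {k N : ℕ} (l : Fin k) (u : Joint k →₀ ℂ) (hu : u ∈ upTo k N) :
    bsGenerator l u ∈ upTo k N := by
  rw [upTo, Finsupp.supported_eq_span_single] at hu
  induction hu using Submodule.span_induction with
  | zero => simp
  | add x y _ _ hx hy => rw [map_add]; exact add_mem hx hy
  | smul c x _ hx => rw [map_smul]; exact Submodule.smul_mem _ _ hx
  | mem x hx =>
    obtain ⟨⟨m, n⟩, hp, rfl⟩ := hx
    have hp' : ∑ i, m i + n ≤ N := hp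
    simp only [bsGenerator, LinearMap.sub_apply, LinearMap.comp_apply, aRaise, bLower, aLower, bRaise,
      Finsupp.linearCombination_single, one_smul]
    refine sub_mem ?_ ?_
    · by_cases hn : n = 0
      · simp [hn]
      · refine Submodule.smul_mem _ _ (Finsupp.single_mem_supported ℂ _ ?_)
        have := sum_update_add m l (m l + 1)
        show ∑ i, Function.update m l (m l + 1) i + (n - 1) ≤ N
        omega
    · by_cases hm : m l = 0
      · simp [hm]
      · refine Submodule.smul_mem _ _ (Finsupp.single_mem_supported ℂ _ ?_)
        have := sum_update_add m l (m l - 1)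
        show ∑ i, Function.update m l (m l - 1) i + (n + 1) ≤ N
        omega

theorem exists_exp_of_skew {E : Type*} [NormedAddCommGroup E] [InnerProductSpace ℂ E] [CompleteSpace E]
    (g : E →L[ℂ] E) (hg : -g = ContinuousLinearMap.adjoint g) (θ : ℝ) :
    ∃ V : E → E, (∀ x y, ⟪V x, V y⟫_ℂ = ⟪x, y⟫_ℂ) ∧
      ∀ x, HasSum (fun r : ℕ => ((θ ^ r / r.factorial : ℝ) : ℂ) • (g ^ r) x) (V x) := by
  have hskew : (θ : ℂ) • g ∈ skewAdjoint (E →L[ℂ] E) := by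
    have h1 : star (θ : ℂ) = θ := Complex.conj_ofReal θ
    rw [skewAdjoint.mem_iff, star_smul, h1, ContinuousLinearMap.star_eq_adjoint, ← hg, smul_neg]
  let +nondep : NormedAlgebra ℚ (E →L[ℂ] E) := .restrictScalars ℚ ℂ _
  have hU := NormedSpace.exp_mem_unitary_of_mem_skewAdjoint hskew
  refine ⟨fun x => NormedSpace.exp ((θ : ℂ) • g) x, fun x y =>
    ContinuousLinearMap.inner_map_map_of_mem_unitary hU x y, fun x => ?_⟩
  have hs := (NormedSpace.exp_series_hasSum_exp' (𝕂 := ℂ) ((θ : ℂ) • g)).mapL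
    (ContinuousLinearMap.apply ℂ E x)
  convert! hs using 2 with r
  rw [map_smul, ContinuousLinearMap.apply_apply, smul_pow, smul_apply, smul_smul]
  congr 1
  push_cast
  ring

/-- On the vectors with at most `N` photons the exponential series of the generator converges to an
inner product preserving map. -/
theorem exists_exp {k : ℕ} (θ : ℝ) (l : Fin k) (N : ℕ) :
    ∃ (E : Submodule ℂ (NumberSpace (Joint k))) (V : E → E), (∀ x y, ⟪V x, V y⟫_ℂ = ⟪x, y⟫_ℂ) ∧
      ∀ u ∈ upTo k N, ∃ x : E, (x : NumberSpace (Joint k)) = embed _ u ∧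
        HasSum (fun r : ℕ => ((θ ^ r / r.factorial : ℝ) : ℂ) • embed (Joint k) ((bsGenerator l ^ r) u))
          (V x : NumberSpace (Joint k)) := by
  obtain ⟨G, hG⟩ : ∃ G : upTo k N →ₗ[ℂ] upTo k N, ∀ w, (G w : Joint k →₀ ℂ) = bsGenerator l w :=
    ⟨(bsGenerator l).restrict (fun u hu => bsGenerator_mem l u hu), fun w => rfl⟩
  obtain ⟨E, e, he⟩ : ∃ (E : Submodule ℂ (NumberSpace (Joint k))) (e : upTo k N ≃ₗ[ℂ] E),
      ∀ w, (e w : NumberSpace (Joint k)) = embed _ (w : Joint k →₀ ℂ) :=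
    ⟨_, Submodule.equivMapOfInjective _ (embed_injective _) (upTo k N), fun w => rfl⟩
  have hfin : FiniteDimensional ℂ E := Module.Finite.equiv e
  have hcomp : CompleteSpace E := FiniteDimensional.complete ℂ E
  obtain ⟨g, hg⟩ : ∃ g : E →L[ℂ] E, ∀ w, g (e w) = e (G w) :=
    ⟨LinearMap.toContinuousLinearMap (e.conj G), fun w => by simp [LinearEquiv.conj_apply]⟩
  have hskew : -g = ContinuousLinearMap.adjoint g := by
    rw [ContinuousLinearMap.eq_adjoint_iff]
    intro x y
    obtain ⟨x, rfl⟩ := e.surjective x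
    obtain ⟨y, rfl⟩ := e.surjective y
    rw [neg_apply, hg, hg, inner_neg_left, Submodule.coe_inner, Submodule.coe_inner, he, he, he, he, hG,
      hG, inner_bsGenerator, neg_neg]
  obtain ⟨V, hV, hs⟩ := exists_exp_of_skew g hskew θ
  refine ⟨E, V, hV, fun u hu => ⟨e ⟨u, hu⟩, he _, ?_⟩⟩
  have hpow : ∀ r : ℕ, (((g ^ r) (e ⟨u, hu⟩) : E) : NumberSpace (Joint k))
      = embed _ ((bsGenerator l ^ r) u) := by
    have h1 : ∀ r : ℕ, (g ^ r) (e ⟨u, hu⟩) = e ((G ^ r) ⟨u, hu⟩) := by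
      intro r
      induction r with
      | zero => rfl
      | succ r ih => rw [pow_succ', mul_apply_eq_comp, ih, hg, pow_succ',
          Module.End.mul_apply]
    have h2 : ∀ r : ℕ, (((G ^ r) ⟨u, hu⟩ : upTo k N) : Joint k →₀ ℂ) = (bsGenerator l ^ r) u := by
      intro r
      induction r with
      | zero => rfl
      | succ r ih => rw [pow_succ', Module.End.mul_apply, pow_succ', Module.End.mul_apply, ← ih, hG]
    intro r
    rw [h1, he, h2]
  have hs' := (hs (e ⟨u, hu⟩)).mapL E.subtypeL
  convert! hs' using 2 with r
  rw [map_smul, Submodule.subtypeL_apply, hpow]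

/-- The vector `exp[θ (a_l† b - a_l b†)] |p⟩ = ∑ᵣ θ^r/r! (a_l† b - a_l b†)^r |p⟩`. -/
def bsVector {k : ℕ} (θ : ℝ) (l : Fin k) (p : Joint k) : NumberSpace (Joint k) :=
  ∑' r : ℕ, ((θ ^ r / r.factorial : ℝ) : ℂ) • embed (Joint k) ((bsGenerator l ^ r) (Finsupp.single p 1))

theorem orthonormal_bsVector {k : ℕ} (θ : ℝ) (l : Fin k) : Orthonormal ℂ (bsVector θ l) := by
  rw [orthonormal_iff_ite]
  intro p q
  obtain ⟨E, V, hV, h⟩ := exists_exp θ l (max (∑ i, p.1 i + p.2) (∑ i, q.1 i + q.2))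
  obtain ⟨x, hx, hxs⟩ := h (Finsupp.single p 1)
    (Finsupp.single_mem_supported ℂ _ (Set.mem_ofPred_eq ▸ le_max_left _ _))
  obtain ⟨y, hy, hys⟩ := h (Finsupp.single q 1)
    (Finsupp.single_mem_supported ℂ _ (Set.mem_ofPred_eq ▸ le_max_right _ _))
  rw [bsVector, bsVector, hxs.tsum_eq, hys.tsum_eq, ← Submodule.coe_inner, hV, Submodule.coe_inner,
    hx, hy, embed_single, embed_single, one_smul, one_smul]
  exact orthonormal_iff_ite.1 orthonormal_ket p q

/-- The beam splitter `U_λ = exp[arccos √λ (a_l† b - a_l b†)]` of transmissivity `lam` between signal `l` and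
the environment: the bounded operator that is given by the exponential series on the number basis. -/
def beamSplitter {k : ℕ} (lam : ℝ) (l : Fin k) : Op (Joint k) :=
  (ofOrthonormal (orthonormal_bsVector (Real.arccos (Real.sqrt lam)) l)).toContinuousLinearMap

theorem beamSplitter_ket {k : ℕ} (lam : ℝ) (l : Fin k) (p : Joint k) :
    HasSum (fun r : ℕ => ((Real.arccos (Real.sqrt lam) ^ r / r.factorial : ℝ) : ℂ) •
      embed (Joint k) ((bsGenerator l ^ r) (Finsupp.single p 1))) (beamSplitter lam l (ket p)) := by
  obtain ⟨E, V, -, h⟩ := exists_exp (Real.arccos (Real.sqrt lam)) l (∑ i, p.1 i + p.2)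
  obtain ⟨x, -, hs⟩ := h (Finsupp.single p 1) (Finsupp.single_mem_supported ℂ _ (Set.mem_ofPred_eq ▸ le_rfl))
  have : beamSplitter lam l (ket p) = bsVector (Real.arccos (Real.sqrt lam)) l p :=
    ofOrthonormal_ket (orthonormal_bsVector _ l) p
  rw [this, bsVector, hs.tsum_eq]
  exact hs

/-- `U^{(S_k E)} ⋯ U^{(S_1 E)}`: the environment meets signal `0` first and signal `k - 1` last. -/
def interaction (k : ℕ) (lam : ℝ) : Op (Joint k) := (List.ofFn fun l : Fin k => beamSplitter lam l).reverse.prod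

/-! ### Achievable environment states -/

/-- The environment state `Tr_{S_1 … S_k}[W (ρ ⊗ σ₀) W†]`, `W = U^{(S_k E)} ⋯ U^{(S_1 E)}`, that the `k`
trigger signals in the joint state `ρ` produce from the environment state `σ₀`. -/
def environmentOutput {k : ℕ} (lam : ℝ) (σ₀ : Op ℕ) (ρ : Op (Fin k → ℕ)) : Op ℕ :=
  partialTrace (interaction k lam ∘L tensorOp ρ σ₀ ∘L ContinuousLinearMap.adjoint (interaction k lam))

/-- `σ` is produced from `σ₀` by `k` trigger signals in some joint, possibly entangled, state. -/
def AchievableWith (k : ℕ) (lam : ℝ) (σ₀ σ : Op ℕ) : Prop :=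
  ∃ ρ : Op (Fin k → ℕ), IsState ρ ∧ σ = environmentOutput lam σ₀ ρ

/-- `σ` is `(λ, σ₀)`-achievable. -/
def Achievable (lam : ℝ) (σ₀ σ : Op ℕ) : Prop := ∃ k : ℕ, AchievableWith k lam σ₀ σ

end Bosonic

end

noncomputable section

namespace Bosonic

/-! ### Thermal states -/

/-! Let `W` be the product of the beam splitters. If the output is `|n⟩⟨n|`, the positive operator
`W (ρ ⊗ τ_ν) W†` has no diagonal weight on environment photon numbers other than `n`, so every
vector in the range of `W (ρ ⊗ τ_ν)` has exactly `n` environment photons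
(`interaction_apply_eq_zero`). Since `τ_ν` is diagonal, this applies to `W (ψ ⊗ |m⟩)` for a fixed
nonzero `ψ = ρ|i₀⟩` and every `m` of nonzero thermal weight.

Each beam splitter rotates the pair `(b†, a_l†)`. Hence `W b† = (c b† + A) W` and `b† W = W (c b† +
A')`, where `c = λ^(k/2) ≠ 0` and `A`, `A'` are combinations of the `a_l†`, which leave the
environment photon number alone (`bsChain_bRaise`, `bRaise_bsChain`).

For `m = 0` the input `x` is orthogonal to the range of `b†`, so `W x` is orthogonal to the range of
`c b† + A`. If `W x` had `n = j + 1` photons in the environment, pairing it with `(c b† + A)|m', j⟩`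
would remove the `A` part and leave a nonzero multiple of the `(m', n)` component; all components
would vanish. Thus `n = 0`. If moreover `ν > 0`, then `m = 1` has weight too, and the second
relation excludes in the same way a one-photon environment that ends in the vacuum.

The creation operators are unbounded, so these relations are proved on finite combinations of number
vectors. The generator conserves the total photon number, which reduces its exponential to finite
dimensions.

For the converse, the joint vacuum is fixed by every beam splitter. -/

theorem norm_ket {I : Type} [DecidableEq I] (i : I) : ‖(ket i : NumberSpace I)‖ = 1 :=
  orthonormal_ket.1 i

theorem thermalState_ket {ν : ℝ} (hν : 0 ≤ ν) (m : ℕ) :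
    thermalState ν (ket m) = ((1 / (ν + 1) * (ν / (ν + 1)) ^ m : ℝ) : ℂ) • ket m := by
  have hr0 : 0 ≤ ν / (ν + 1) := by positivity
  have hr1 : ν / (ν + 1) < 1 := by rw [div_lt_one (by positivity)]; linarith
  have hsum : Summable fun n : ℕ => (((ν / (ν + 1)) ^ n : ℝ) : ℂ) • fockState n := by
    refine Summable.of_norm_bounded (summable_geometric_of_lt_one hr0 hr1) fun n => ?_
    rw [norm_smul, fockState, fockVector_eq_ket, InnerProductSpace.norm_rankOne,
      orthonormal_ket.1, Complex.norm_real, Real.norm_of_nonneg (by positivity)]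
    simp
  have h := hsum.hasSum.mapL (ContinuousLinearMap.apply ℂ _ (ket m))
  have h' : HasSum (fun n : ℕ => (((ν / (ν + 1)) ^ n : ℝ) : ℂ) • fockState n (ket m))
      ((((ν / (ν + 1)) ^ m : ℝ) : ℂ) • ket m) := by
    have h0 := hasSum_ite_eq m ((((ν / (ν + 1)) ^ m : ℝ) : ℂ) • (ket m : NumberSpace ℕ))
    convert! h0 using 2 with n
    rcases eq_or_ne n m with rfl | hn
    · simp [fockState, fockVector_eq_ket, norm_ket]
    · simp [fockState, fockVector_eq_ket, inner_ket, ket_apply, hn, hn.symm]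
  rw [thermalState, smul_apply, ← ContinuousLinearMap.apply_apply (𝕜 := ℂ) (ket m), h.unique h', smul_smul]
  push_cast
  rfl

/-! ### Tensor products of operators -/

theorem ampLeft_tensorKet {I J : Type} [DecidableEq I] [DecidableEq J] (A : Op I) (j : J)
    (x : NumberSpace I) : ampLeft A (tensorKet j x) = tensorKet j (A x) := by
  have h1 := ((hasSum_ket x).mapL (tensorKet (J := J) j).toContinuousLinearMap).mapL (ampLeft A)
  have h2 := ((hasSum_ket x).mapL A).mapL (tensorKet (J := J) j).toContinuousLinearMap
  refine HasSum.unique h1 ?_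
  convert! h2 using 2 with i
  simp only [map_smul, LinearIsometry.coe_toContinuousLinearMap]
  rw [← ampLeft_ket]
  simp [tensorKet, ofOrthonormal_ket]

theorem ketTensor_ket {I J : Type} [DecidableEq I] [DecidableEq J] (i : I) (j : J) :
    ketTensor i (ket j) = ket (i, j) :=
  ofOrthonormal_ket _ _

theorem tensorKet_ket {I J : Type} [DecidableEq I] [DecidableEq J] (i : I) (j : J) :
    tensorKet j (ket i) = ket (i, j) :=
  ofOrthonormal_ket _ _

theorem ampRight_tensorKet {I J : Type} [DecidableEq I] [DecidableEq J] (B : Op J) (t : J → ℂ)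
    (hB : ∀ j, B (ket j) = t j • ket j) (j : J) (x : NumberSpace I) :
    ampRight B (tensorKet j x) = t j • tensorKet j x := by
  have h1 := ((hasSum_ket x).mapL (tensorKet (J := J) j).toContinuousLinearMap).mapL (ampRight B)
  have h2 := ((hasSum_ket x).mapL (tensorKet (J := J) j).toContinuousLinearMap).const_smul (t j)
  refine HasSum.unique h1 ?_
  convert! h2 using 2 with i
  simp only [map_smul, LinearIsometry.coe_toContinuousLinearMap, tensorKet_ket, ampRight_ket, hB,
    ketTensor_ket]
  exact smul_comm _ _ _

/-- With `B` diagonal, the slices `x ⊗ |j⟩` are invariant under `A ⊗ B`, so a general tensor product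
never has to be handled beyond this case. -/
theorem tensorOp_tensorKet {I J : Type} [DecidableEq I] [DecidableEq J] (A : Op I) (B : Op J)
    (t : J → ℂ) (hB : ∀ j, B (ket j) = t j • ket j) (j : J) (x : NumberSpace I) :
    tensorOp A B (tensorKet j x) = t j • tensorKet j (A x) := by
  rw [tensorOp, ContinuousLinearMap.comp_apply, ampRight_tensorKet B t hB, map_smul, ampLeft_tensorKet]

theorem exists_hasSum_tensorKet {I J : Type} [DecidableEq I] [DecidableEq J]
    (x : NumberSpace (I × J)) : ∃ f : J → NumberSpace I,
      HasSum (fun j => tensorKet j (f j)) x ∧ ∀ j w, ⟪x, tensorKet j w⟫_ℂ = ⟪f j, w⟫_ℂ := by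
  -- The range of the glueing isometry is the closed span of all slices, and the partial sums of the
  -- number expansion of `x` lie in that span.
  have hx : x ∈ LinearMap.range (glueLeft I J).toLinearMap := by
    rw [glueLeft, OrthogonalFamily.range_linearIsometry]
    refine mem_closure_of_tendsto (hasSum_ket x) (Filter.Eventually.of_forall fun s => ?_)
    refine sum_mem fun p _ => Submodule.smul_mem _ _ ?_
    refine Submodule.mem_iSup_of_mem p.2 ⟨ket p.1, ?_⟩
    exact tensorKet_ket p.1 p.2
  obtain ⟨f, rfl⟩ := hx
  refine ⟨f, orthogonalFamily_tensorKet.hasSum_linearIsometry f, fun j w => ?_⟩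
  have h : tensorKet j w = glueLeft I J (lp.single 2 j w) := by
    rw [glueLeft, OrthogonalFamily.linearIsometry_apply_single]
  rw [h]
  exact ((glueLeft I J).inner_map_map _ _).trans (lp.inner_single_right j w f)

open scoped ComplexOrder in
/-- `A ⊗ B` is positive for positive `A` and diagonal nonnegative `B`. -/
theorem isPositive_tensorOp {I J : Type} [DecidableEq I] [DecidableEq J] (A : Op I) (hA : A.IsPositive)
    (B : Op J) (t : J → ℝ) (ht : ∀ j, 0 ≤ t j) (hB : ∀ j, B (ket j) = (t j : ℂ) • ket j) :
    (tensorOp A B).IsPositive := by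
  rw [ContinuousLinearMap.isPositive_iff_complex]
  intro x
  obtain ⟨f, hf, hx⟩ := exists_hasSum_tensorKet x
  have h := ((hf.mapL (tensorOp A B)).mapL (innerSL ℂ x))
  simp only [tensorOp_tensorKet A B (fun j => (t j : ℂ)) hB, map_smul, innerSL_apply_apply, hx,
    smul_eq_mul] at h
  -- Slice by slice the expectation is `∑ⱼ tⱼ ⟨fⱼ, A fⱼ⟩`, a sum of nonnegative terms.
  have h0 : 0 ≤ ⟪x, tensorOp A B x⟫_ℂ :=
    h.nonneg fun j => mul_nonneg (by exact_mod_cast ht j) (hA.inner_nonneg_right (f j))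
  obtain ⟨h1, h2⟩ := Complex.nonneg_iff.1 h0
  rw [← inner_conj_symm, Complex.conj_eq_iff_im.2 h2.symm]
  exact ⟨Complex.ext rfl h2, h1⟩

/-! ### States and positive operators -/

theorem IsState.exists_ne_zero {I : Type} [DecidableEq I] {ρ : Op I} (hρ : IsState ρ) :
    ∃ i, ρ (ket i) ≠ 0 := by
  by_contra! h
  have h1 := hρ.2
  simp only [h, inner_zero_right] at h1
  exact zero_ne_one (hasSum_zero.unique h1)

theorem isState_rankOne_ket {I : Type} [DecidableEq I] (i : I) :
    IsState (InnerProductSpace.rankOne ℂ (ket i) (ket i)) := by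
  refine ⟨InnerProductSpace.isPositive_rankOne_self _, ?_⟩
  convert! hasSum_ite_eq i (1 : ℂ) using 2 with j
  rcases eq_or_ne j i with rfl | hj
  · simp [norm_ket]
  · simp [inner_ket, ket_apply, hj]

/-- A positive operator kills the vectors in which its expectation vanishes. -/
theorem apply_eq_zero_of_inner_eq_zero {E : Type*} [NormedAddCommGroup E] [InnerProductSpace ℂ E]
    [CompleteSpace E] {R : E →L[ℂ] E} (hR : R.IsPositive) {z : E} (hz : ⟪z, R z⟫_ℂ = 0) : R z = 0 := by
  -- Writing `R = S* S`, the expectation of `R` in `z` is `‖S z‖²`.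
  obtain ⟨S, rfl⟩ := CStarAlgebra.nonneg_iff_eq_star_mul_self.1 (R.nonneg_iff_isPositive.2 hR)
  rw [mul_apply_eq_comp, ContinuousLinearMap.star_eq_adjoint,
    ContinuousLinearMap.adjoint_inner_right, inner_self_eq_zero] at hz
  rw [mul_apply_eq_comp, hz, map_zero]

/-! ### Commutation relations on finite vectors -/

theorem bLower_bRaise {k : ℕ} (u : Joint k →₀ ℂ) : bLower (bRaise u) = bRaise (bLower u) + u := by
  induction u using Finsupp.induction_linear with
  | zero => simp
  | add u₁ u₂ h₁ h₂ => simp only [map_add, h₁, h₂]; abel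
  | single p c =>
    obtain ⟨m, n⟩ := p
    simp only [bLower, bRaise, Finsupp.linearCombination_single, Finsupp.smul_single, smul_eq_mul]
    have h1 : (Real.sqrt ((n : ℝ) + 1) : ℂ) * Real.sqrt ((n : ℝ) + 1) = n + 1 := by
      rw [← Complex.ofReal_mul, Real.mul_self_sqrt (by positivity)]; push_cast; rfl
    have h2 : (Real.sqrt (n : ℝ) : ℂ) * Real.sqrt (n : ℝ) = n := by
      rw [← Complex.ofReal_mul, Real.mul_self_sqrt (by positivity)]; push_cast; rfl
    obtain _ | n := n
    · simp
    · simp only [Nat.add_sub_cancel, ← Finsupp.single_add]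
      push_cast at h1 h2 ⊢
      rw [mul_assoc, h1, mul_assoc, h2]
      congr 1
      ring

theorem aLower_aRaise {k : ℕ} (l : Fin k) (u : Joint k →₀ ℂ) :
    aLower l (aRaise l u) = aRaise l (aLower l u) + u := by
  induction u using Finsupp.induction_linear with
  | zero => simp
  | add u₁ u₂ h₁ h₂ => simp only [map_add, h₁, h₂]; abel
  | single p c =>
    obtain ⟨m, n⟩ := p
    simp only [aLower, aRaise, Finsupp.linearCombination_single, Finsupp.smul_single, smul_eq_mul,
      Function.update_self, Function.update_idem]
    have h1 : (Real.sqrt ((m l : ℝ) + 1) : ℂ) * Real.sqrt ((m l : ℝ) + 1) = m l + 1 := by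
      rw [← Complex.ofReal_mul, Real.mul_self_sqrt (by positivity)]; push_cast; rfl
    have h2 : (Real.sqrt (m l : ℝ) : ℂ) * Real.sqrt (m l : ℝ) = m l := by
      rw [← Complex.ofReal_mul, Real.mul_self_sqrt (by positivity)]; push_cast; rfl
    have h0 : Function.update m l (m l) = m := Function.update_eq_self l m
    rcases hm : m l with _ | x
    · rw [hm] at h0
      simp [h0]
    · rw [hm] at h0 h1 h2
      simp only [Nat.add_sub_cancel, h0, ← Finsupp.single_add]
      push_cast at h1 h2 ⊢
      rw [mul_assoc, h1, mul_assoc, h2]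
      congr 1
      ring

theorem aRaise_bRaise {k : ℕ} (l : Fin k) (u : Joint k →₀ ℂ) :
    aRaise l (bRaise u) = bRaise (aRaise l u) := by
  induction u using Finsupp.induction_linear with
  | zero => simp
  | add u₁ u₂ h₁ h₂ => simp only [map_add, h₁, h₂]
  | single p c =>
    simp only [aRaise, bRaise, Finsupp.linearCombination_single, Finsupp.smul_single, smul_eq_mul]
    congr 1
    ring

theorem aRaise_aRaise {k : ℕ} (l l' : Fin k) (u : Joint k →₀ ℂ) :
    aRaise l (aRaise l' u) = aRaise l' (aRaise l u) := by
  rcases eq_or_ne l l' with rfl | hl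
  · rfl
  induction u using Finsupp.induction_linear with
  | zero => simp
  | add u₁ u₂ h₁ h₂ => simp only [map_add, h₁, h₂]
  | single p c =>
    simp only [aRaise, Finsupp.linearCombination_single, Finsupp.smul_single, smul_eq_mul,
      Function.update_of_ne hl, Function.update_of_ne hl.symm, Function.update_comm hl]
    congr 1
    ring

theorem aLower_aRaise_of_ne {k : ℕ} {l l' : Fin k} (hl : l ≠ l') (u : Joint k →₀ ℂ) :
    aLower l (aRaise l' u) = aRaise l' (aLower l u) := by
  induction u using Finsupp.induction_linear with
  | zero => simp
  | add u₁ u₂ h₁ h₂ => simp only [map_add, h₁, h₂]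
  | single p c =>
    simp only [aRaise, aLower, Finsupp.linearCombination_single, Finsupp.smul_single, smul_eq_mul,
      Function.update_of_ne hl, Function.update_of_ne hl.symm, Function.update_comm hl]
    congr 1
    ring

/-- Together with `bsGenerator_aRaise` this says that the commutator with the generator acts on the
span of `b†` and `a_l†` as an infinitesimal rotation, whose eigenvectors are `b† ± i a_l†`. -/
theorem bsGenerator_bRaise {k : ℕ} (l : Fin k) (u : Joint k →₀ ℂ) :
    bsGenerator l (bRaise u) = bRaise (bsGenerator l u) + aRaise l u := by
  simp only [bsGenerator, LinearMap.sub_apply, LinearMap.comp_apply, map_sub, bLower_bRaise, map_add,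
    aLower_bRaise, aRaise_bRaise]
  abel

theorem bsGenerator_aRaise {k : ℕ} (l : Fin k) (u : Joint k →₀ ℂ) :
    bsGenerator l (aRaise l u) = aRaise l (bsGenerator l u) - bRaise u := by
  simp only [bsGenerator, LinearMap.sub_apply, LinearMap.comp_apply, map_sub, ← aRaise_bLower,
    aLower_bRaise, aRaise_bRaise, aLower_aRaise, map_add]
  abel

theorem bsGenerator_aRaise_of_ne {k : ℕ} {l l' : Fin k} (hl : l ≠ l') (u : Joint k →₀ ℂ) :
    bsGenerator l (aRaise l' u) = aRaise l' (bsGenerator l u) := by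
  simp only [bsGenerator, LinearMap.sub_apply, LinearMap.comp_apply, map_sub, ← aRaise_bLower,
    aLower_bRaise, aRaise_bRaise, aLower_aRaise_of_ne hl, aRaise_aRaise l l']

/-! ### Photon number bounds -/

theorem bRaise_mem {k N : ℕ} (u : Joint k →₀ ℂ) (hu : u ∈ upTo k N) : bRaise u ∈ upTo k (N + 1) := by
  rw [upTo, Finsupp.supported_eq_span_single] at hu
  induction hu using Submodule.span_induction with
  | zero => simp
  | add x y _ _ hx hy => rw [map_add]; exact add_mem hx hy
  | smul c x _ hx => rw [map_smul]; exact Submodule.smul_mem _ _ hx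
  | mem x hx =>
    obtain ⟨⟨m, n⟩, hp, rfl⟩ := hx
    have hp' : ∑ i, m i + n ≤ N := hp
    rw [bRaise, Finsupp.linearCombination_single, one_smul]
    refine Finsupp.single_mem_supported ℂ _ ?_
    show ∑ i, m i + (n + 1) ≤ N + 1
    omega

theorem aRaise_mem {k N : ℕ} (l : Fin k) (u : Joint k →₀ ℂ) (hu : u ∈ upTo k N) :
    aRaise l u ∈ upTo k (N + 1) := by
  rw [upTo, Finsupp.supported_eq_span_single] at hu
  induction hu using Submodule.span_induction with
  | zero => simp
  | add x y _ _ hx hy => rw [map_add]; exact add_mem hx hy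
  | smul c x _ hx => rw [map_smul]; exact Submodule.smul_mem _ _ hx
  | mem x hx =>
    obtain ⟨⟨m, n⟩, hp, rfl⟩ := hx
    have hp' : ∑ i, m i + n ≤ N := hp
    rw [aRaise, Finsupp.linearCombination_single, one_smul]
    refine Finsupp.single_mem_supported ℂ _ ?_
    have := sum_update_add m l (m l + 1)
    show ∑ i, Function.update m l (m l + 1) i + n ≤ N + 1
    omega

theorem exists_mem_upTo {k : ℕ} (u : Joint k →₀ ℂ) : ∃ N, u ∈ upTo k N := by
  refine ⟨u.support.sup fun p => ∑ i, p.1 i + p.2, ?_⟩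
  rw [upTo, Finsupp.mem_supported]
  intro p hp
  exact Finset.le_sup (f := fun p : Joint k => ∑ i, p.1 i + p.2) hp

/-! ### The beam splitter on finite vectors -/

/-- The operator `exp(θ g)`. -/
def expOp {E : Type*} [NormedAddCommGroup E] [NormedSpace ℂ E] (θ : ℝ) (g : E →L[ℂ] E) : E →L[ℂ] E :=
  NormedSpace.exp ((θ : ℂ) • g)

theorem expOp_hasSum {E : Type*} [NormedAddCommGroup E] [NormedSpace ℂ E] [CompleteSpace E] (θ : ℝ)
    (g : E →L[ℂ] E) (x : E) :
    HasSum (fun r : ℕ => ((θ ^ r / r.factorial : ℝ) : ℂ) • (g ^ r) x) (expOp θ g x) := by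
  let +nondep : NormedAlgebra ℚ (E →L[ℂ] E) := .restrictScalars ℚ ℂ _
  have h := (NormedSpace.exp_series_hasSum_exp' (𝕂 := ℂ) ((θ : ℂ) • g)).mapL
    (ContinuousLinearMap.apply ℂ E x)
  convert! h using 2 with r
  rw [map_smul, ContinuousLinearMap.apply_apply, smul_pow, smul_apply, smul_smul]
  congr 1
  push_cast
  ring

/-- If `h D = D (g + z)` then `exp(θ h) D = exp(z θ) D exp(θ g)`. -/
theorem expOp_intertwine {E F : Type*} [NormedAddCommGroup E] [NormedSpace ℂ E] [CompleteSpace E]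
    [NormedAddCommGroup F] [NormedSpace ℂ F] [CompleteSpace F] (g : E →L[ℂ] E) (h : F →L[ℂ] F)
    (D : E →L[ℂ] F) (z : ℂ) (θ : ℝ) (H : ∀ x, h (D x) = D (g x) + z • D x) (x : E) :
    expOp θ h (D x) = Complex.exp (z * θ) • D (expOp θ g x) := by
  let +nondep : NormedAlgebra ℚ (E →L[ℂ] E) := .restrictScalars ℚ ℂ _
  -- The hypothesis reads `h D = D (g + z)`, and it passes to powers and then to the exponential
  -- series.
  have hpow : ∀ r : ℕ, (h ^ r) (D x) = D (((g + algebraMap ℂ (E →L[ℂ] E) z) ^ r) x) := by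
    intro r
    induction r with
    | zero => simp
    | succ r ih =>
      rw [pow_succ', mul_apply_eq_comp, ih, pow_succ', mul_apply_eq_comp]
      simp [Algebra.algebraMap_eq_smul_one, H]
  have h3 : expOp θ h (D x) = D (expOp θ (g + algebraMap ℂ (E →L[ℂ] E) z) x) := by
    refine (expOp_hasSum θ h (D x)).unique ?_
    convert! (expOp_hasSum θ (g + algebraMap ℂ (E →L[ℂ] E) z) x).mapL D using 2 with r
    simp [hpow]
  have h4 : (θ : ℂ) • (g + algebraMap ℂ (E →L[ℂ] E) z)
      = (θ : ℂ) • g + algebraMap ℂ (E →L[ℂ] E) (z * θ) := by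
    rw [smul_add, Algebra.algebraMap_eq_smul_one, Algebra.algebraMap_eq_smul_one, smul_smul, mul_comm z]
  -- The scalar `z θ` commutes with `g`, so its exponential splits off as a factor.
  rw [h3, expOp, h4, NormedSpace.exp_add_of_commute (Algebra.commutes _ _).symm,
    ← NormedSpace.algebraMap_exp_comm, ← Complex.exp_eq_exp_ℂ]
  simp [Algebra.algebraMap_eq_smul_one, expOp]

theorem beamSplitter_hasSum {k : ℕ} (lam : ℝ) (l : Fin k) (u : Joint k →₀ ℂ) :
    HasSum (fun r : ℕ => ((Real.arccos (Real.sqrt lam) ^ r / r.factorial : ℝ) : ℂ) •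
      embed (Joint k) ((bsGenerator l ^ r) u)) (beamSplitter lam l (embed _ u)) := by
  induction u using Finsupp.induction_linear with
  | zero => simp
  | add u₁ u₂ h₁ h₂ => simpa only [map_add, smul_add] using h₁.add h₂
  | single p c =>
    have h := (beamSplitter_ket lam l p).const_smul c
    have hc : Finsupp.single p c = c • Finsupp.single p (1 : ℂ) := by simp
    rw [hc]
    simp only [map_smul, embed_single, one_smul] at h ⊢
    convert! h using 2 with r
    exact smul_comm _ _ _

/-- The vectors of the number space with at most `N` photons in total. -/
def sector (k N : ℕ) : Submodule ℂ (NumberSpace (Joint k)) := (upTo k N).map (embed (Joint k))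

instance (k N : ℕ) : Module.Finite ℂ (sector k N) :=
  inferInstanceAs (Module.Finite ℂ ((upTo k N).map (embed (Joint k))))

instance (k N : ℕ) : CompleteSpace (sector k N) := FiniteDimensional.complete ℂ _

theorem embed_mem_sector {k N : ℕ} {u : Joint k →₀ ℂ} (hu : u ∈ upTo k N) : embed _ u ∈ sector k N :=
  Submodule.mem_map_of_mem hu

/-- Sectors are finite-dimensional, so every linear map between them is bounded. This turns ladder
operators and generators into operators to which the exponential calculus applies. -/
theorem exists_sectorMap {k N M : ℕ} (T : (Joint k →₀ ℂ) →ₗ[ℂ] (Joint k →₀ ℂ))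
    (hT : ∀ u ∈ upTo k N, T u ∈ upTo k M) :
    ∃ T' : sector k N →L[ℂ] sector k M, ∀ u (hu : u ∈ upTo k N),
      T' ⟨embed _ u, embed_mem_sector hu⟩ = ⟨embed _ (T u), embed_mem_sector (hT u hu)⟩ := by
  obtain ⟨e, he⟩ : ∃ e : upTo k N ≃ₗ[ℂ] sector k N, ∀ w, e w = ⟨embed _ w.1, embed_mem_sector w.2⟩ :=
    ⟨Submodule.equivMapOfInjective _ (embed_injective _) (upTo k N), fun w => rfl⟩
  obtain ⟨f, hf⟩ : ∃ f : upTo k M ≃ₗ[ℂ] sector k M, ∀ w, f w = ⟨embed _ w.1, embed_mem_sector w.2⟩ :=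
    ⟨Submodule.equivMapOfInjective _ (embed_injective _) (upTo k M), fun w => rfl⟩
  refine ⟨LinearMap.toContinuousLinearMap (f.toLinearMap ∘ₗ T.restrict hT ∘ₗ e.symm.toLinearMap),
    fun u hu => ?_⟩
  rw [← he ⟨u, hu⟩]
  simp [hf]

theorem beamSplitter_eq_exp {k N : ℕ} (lam : ℝ) (l : Fin k) (g : sector k N →L[ℂ] sector k N)
    (hg : ∀ u (hu : u ∈ upTo k N), g ⟨embed _ u, embed_mem_sector hu⟩
      = ⟨embed _ (bsGenerator l u), embed_mem_sector (bsGenerator_mem l u hu)⟩)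
    (u : Joint k →₀ ℂ) (hu : u ∈ upTo k N) :
    beamSplitter lam l (embed _ u)
      = expOp (Real.arccos (Real.sqrt lam)) g ⟨embed _ u, embed_mem_sector hu⟩ := by
  have h := (expOp_hasSum (Real.arccos (Real.sqrt lam)) g ⟨embed _ u, embed_mem_sector hu⟩).mapL
    (sector k N).subtypeL
  have hpow : ∀ r : ℕ, ∃ h : (bsGenerator l ^ r) u ∈ upTo k N,
      (g ^ r) ⟨embed _ u, embed_mem_sector hu⟩
        = ⟨embed _ ((bsGenerator l ^ r) u), embed_mem_sector h⟩ := by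
    intro r
    induction r with
    | zero => exact ⟨hu, rfl⟩
    | succ r ih =>
      obtain ⟨h1, h2⟩ := ih
      refine ⟨?_, ?_⟩
      · rw [pow_succ', Module.End.mul_apply]
        exact bsGenerator_mem l _ h1
      · simp only [pow_succ', mul_apply_eq_comp, h2, Module.End.mul_apply]
        exact hg _ h1
  refine (beamSplitter_hasSum lam l u).unique ?_
  convert! h using 2 with r
  obtain ⟨h1, h2⟩ := hpow r
  rw [h2, map_smul, Submodule.subtypeL_apply]

/-- The beam splitter on finite vectors: it preserves the photon number bound and commutes, up to the
phase `exp(z θ)`, with every `D` such that `g D = D (g + z)`. -/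
theorem exists_bsFinite {k : ℕ} (lam : ℝ) (l : Fin k) :
    ∃ T : Module.End ℂ (Joint k →₀ ℂ), (∀ u, embed _ (T u) = beamSplitter lam l (embed _ u)) ∧
      (∀ N, ∀ u ∈ upTo k N, T u ∈ upTo k N) ∧
      ∀ (D : Module.End ℂ (Joint k →₀ ℂ)) (z : ℂ),
        (∀ N, ∀ u ∈ upTo k N, D u ∈ upTo k (N + 1)) →
        (∀ u, bsGenerator l (D u) = D (bsGenerator l u) + z • D u) →
        ∀ u, T (D u) = Complex.exp (z * Real.arccos (Real.sqrt lam)) • D (T u) := by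
  -- The exponential of the restricted generator stays in the sector, so the image of a finite
  -- vector is again finite.
  have hmem : ∀ N, ∀ u ∈ upTo k N, beamSplitter lam l (embed _ u) ∈ sector k N := by
    intro N u hu
    obtain ⟨g, hg⟩ := exists_sectorMap (bsGenerator l) (fun u hu => bsGenerator_mem (N := N) l u hu)
    rw [beamSplitter_eq_exp lam l g hg u hu]
    exact Subtype.property _
  have hrange : ∀ u, beamSplitter lam l (embed _ u) ∈ LinearMap.range (embed (Joint k)) := by
    intro u
    obtain ⟨N, hN⟩ := exists_mem_upTo u
    obtain ⟨v, -, hv⟩ := hmem N u hN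
    exact ⟨v, hv⟩
  obtain ⟨e, he⟩ : ∃ e : (Joint k →₀ ℂ) ≃ₗ[ℂ] LinearMap.range (embed (Joint k)),
      ∀ u, (e u : NumberSpace (Joint k)) = embed _ u :=
    ⟨LinearEquiv.ofInjective _ (embed_injective _), fun u => rfl⟩
  obtain ⟨T, hT⟩ : ∃ T : Module.End ℂ (Joint k →₀ ℂ),
      ∀ u, embed _ (T u) = beamSplitter lam l (embed _ u) := by
    refine ⟨e.symm.toLinearMap ∘ₗ LinearMap.codRestrict _
      ((beamSplitter lam l).toLinearMap ∘ₗ embed (Joint k)) hrange, fun u => ?_⟩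
    rw [← he]
    simp
  have hTN : ∀ N, ∀ u ∈ upTo k N, T u ∈ upTo k N := by
    intro N u hu
    obtain ⟨v, hv, hv'⟩ := hmem N u hu
    rw [← hT] at hv'
    rwa [← embed_injective _ hv']
  refine ⟨T, hT, hTN, fun D z hD hcomm u => embed_injective _ ?_⟩
  obtain ⟨N, hu⟩ := exists_mem_upTo u
  -- `D` may add one photon, so the intertwining takes place between the restrictions `g` and `h` of
  -- one generator to two consecutive sectors.
  obtain ⟨g, hg⟩ := exists_sectorMap (bsGenerator l) (fun u hu => bsGenerator_mem (N := N) l u hu)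
  obtain ⟨h, hh⟩ := exists_sectorMap (bsGenerator l) (fun u hu => bsGenerator_mem (N := N + 1) l u hu)
  obtain ⟨D', hD'⟩ := exists_sectorMap D (hD N)
  have hexp := expOp_intertwine g h D' z (Real.arccos (Real.sqrt lam)) (fun x => by
    obtain ⟨_, v, hv, rfl⟩ := x
    have hv' : v ∈ upTo k N := hv
    ext1
    rw [hg v hv', hD' v hv', hh _ (hD N v hv'), hD' _ (bsGenerator_mem l v hv')]
    simp [hcomm]) ⟨embed _ u, embed_mem_sector hu⟩
  have h1 : expOp (Real.arccos (Real.sqrt lam)) g ⟨embed _ u, embed_mem_sector hu⟩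
      = ⟨embed _ (T u), embed_mem_sector (hTN N u hu)⟩ := by
    ext1
    rw [← beamSplitter_eq_exp lam l g hg u hu, ← hT]
  rw [h1, hD' _ (hTN N u hu), hD' u hu] at hexp
  have h2 := congrArg (Subtype.val) hexp
  rw [← beamSplitter_eq_exp lam l h hh (D u) (hD N u hu), ← hT] at h2
  simpa using h2

/-- The beam splitter on finite vectors. -/
def bsFinite {k : ℕ} (lam : ℝ) (l : Fin k) : Module.End ℂ (Joint k →₀ ℂ) :=
  (exists_bsFinite lam l).choose

theorem embed_bsFinite {k : ℕ} (lam : ℝ) (l : Fin k) (u : Joint k →₀ ℂ) :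
    embed _ (bsFinite lam l u) = beamSplitter lam l (embed _ u) :=
  (exists_bsFinite lam l).choose_spec.1 u

theorem bsFinite_mem {k : ℕ} (lam : ℝ) (l : Fin k) (N : ℕ) (u : Joint k →₀ ℂ) (hu : u ∈ upTo k N) :
    bsFinite lam l u ∈ upTo k N :=
  (exists_bsFinite lam l).choose_spec.2.1 N u hu

theorem bsFinite_intertwine {k : ℕ} (lam : ℝ) (l : Fin k) (D : Module.End ℂ (Joint k →₀ ℂ)) (z : ℂ)
    (hD : ∀ N, ∀ u ∈ upTo k N, D u ∈ upTo k (N + 1))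
    (hg : ∀ u, bsGenerator l (D u) = D (bsGenerator l u) + z • D u) (u : Joint k →₀ ℂ) :
    bsFinite lam l (D u) = Complex.exp (z * Real.arccos (Real.sqrt lam)) • D (bsFinite lam l u) :=
  (exists_bsFinite lam l).choose_spec.2.2 D z hD hg u

/-- An isometry is injective, and an injective endomorphism of the finite-dimensional space `upTo k
N` is onto. -/
theorem bsFinite_surjective {k : ℕ} (lam : ℝ) (l : Fin k) : Function.Surjective (bsFinite lam l) := by
  intro u
  obtain ⟨N, hu⟩ := exists_mem_upTo u
  have hinj : Function.Injective ((bsFinite lam l).restrict (bsFinite_mem lam l N)) := by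
    intro x y hxy
    have h : embed _ (bsFinite lam l x) = embed _ (bsFinite lam l y) :=
      congrArg (embed _) (congrArg Subtype.val hxy)
    rw [embed_bsFinite, embed_bsFinite] at h
    exact Subtype.ext (embed_injective _ ((ofOrthonormal (orthonormal_bsVector _ l)).injective h))
  obtain ⟨v, hv⟩ := (LinearMap.injective_iff_surjective (V := upTo k N)).1 hinj ⟨u, hu⟩
  exact ⟨v, congrArg Subtype.val hv⟩

theorem bsFinite_aRaise_of_ne {k : ℕ} (lam : ℝ) {l l' : Fin k} (hl : l ≠ l') :
    bsFinite lam l * aRaise l' = aRaise l' * bsFinite lam l := by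
  refine LinearMap.ext fun u => ?_
  have h := bsFinite_intertwine lam l (aRaise l') 0 (fun N u hu => aRaise_mem l' u hu)
    (fun u => by simp [bsGenerator_aRaise_of_ne hl]) u
  simpa using h

theorem cos_arccos_sqrt {lam : ℝ} (hlam : lam ≤ 1) :
    Complex.cos (Real.arccos (Real.sqrt lam)) = Real.sqrt lam := by
  rw [← Complex.ofReal_cos, Real.cos_arccos (by linarith [Real.sqrt_nonneg lam])
    (Real.sqrt_le_one.2 hlam)]

/-- For `z = ± i` the operator `b† + z a_l†` is an eigenvector, with eigenvalue `-z`, of the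
commutator with the generator; conjugation by the beam splitter therefore only multiplies it by a
phase. -/
theorem bsFinite_bRaise_add {k : ℕ} (lam : ℝ) (l : Fin k) (u : Joint k →₀ ℂ) (z : ℂ) (hz : z * z = -1) :
    bsFinite lam l (bRaise u + z • aRaise l u)
      = Complex.exp (-z * Real.arccos (Real.sqrt lam)) •
        (bRaise (bsFinite lam l u) + z • aRaise l (bsFinite lam l u)) := by
  refine bsFinite_intertwine lam l (bRaise + z • aRaise l) (-z)
    (fun N u hu => add_mem (bRaise_mem u hu) (Submodule.smul_mem _ _ (aRaise_mem l u hu)))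
    (fun u => ?_) u
  simp only [LinearMap.add_apply, LinearMap.smul_apply, map_add, map_smul, bsGenerator_bRaise,
    bsGenerator_aRaise, smul_add, smul_sub, smul_smul, neg_mul, hz]
  module

theorem bsFinite_bRaise {k : ℕ} (lam : ℝ) (l : Fin k) :
    bsFinite lam l * bRaise = (Complex.cos (Real.arccos (Real.sqrt lam)) • bRaise
      + Complex.sin (Real.arccos (Real.sqrt lam)) • aRaise l) * bsFinite lam l := by
  refine LinearMap.ext fun u => ?_
  have h1 := bsFinite_bRaise_add lam l u Complex.I (by simp)
  have h2 := bsFinite_bRaise_add lam l u (-Complex.I) (by simp)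
  rw [neg_mul, mul_comm Complex.I, ← neg_mul, Complex.exp_mul_I] at h1
  rw [neg_neg, mul_comm Complex.I, Complex.exp_mul_I] at h2
  simp only [Complex.cos_neg, Complex.sin_neg, map_add, map_smul] at h1 h2
  simp only [Module.End.mul_apply, LinearMap.add_apply, LinearMap.smul_apply]
  generalize (Real.arccos (Real.sqrt lam) : ℂ) = θ at *
  generalize bsFinite lam l (bRaise u) = x at *
  generalize bsFinite lam l (aRaise l u) = y at *
  generalize bRaise (bsFinite lam l u) = v at *
  generalize aRaise l (bsFinite lam l u) = w at *
  have hI : Complex.I * Complex.I = -1 := Complex.I_mul_I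
  -- `b†` is the half-sum of the two eigenvectors `b† ± i a_l†`, so Euler's formula yields the
  -- rotation.
  have h3 : x = (1 / 2 : ℂ) • ((x + Complex.I • y) + (x + (-Complex.I) • y)) := by module
  rw [h3, h1, h2]
  simp only [smul_add, smul_smul, add_mul, mul_add]
  match_scalars
  · ring
  · linear_combination (-(Complex.sin θ)) * hI

theorem bsFinite_aRaise {k : ℕ} (lam : ℝ) (l : Fin k) :
    bsFinite lam l * aRaise l = (Complex.cos (Real.arccos (Real.sqrt lam)) • aRaise l
      - Complex.sin (Real.arccos (Real.sqrt lam)) • bRaise) * bsFinite lam l := by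
  refine LinearMap.ext fun u => ?_
  have h1 := bsFinite_bRaise_add lam l u Complex.I (by simp)
  have h2 := bsFinite_bRaise_add lam l u (-Complex.I) (by simp)
  rw [neg_mul, mul_comm Complex.I, ← neg_mul, Complex.exp_mul_I] at h1
  rw [neg_neg, mul_comm Complex.I, Complex.exp_mul_I] at h2
  simp only [Complex.cos_neg, Complex.sin_neg, map_add, map_smul] at h1 h2
  simp only [Module.End.mul_apply, LinearMap.sub_apply, LinearMap.smul_apply]
  generalize (Real.arccos (Real.sqrt lam) : ℂ) = θ at *
  generalize bsFinite lam l (bRaise u) = x at *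
  generalize bsFinite lam l (aRaise l u) = y at *
  generalize bRaise (bsFinite lam l u) = v at *
  generalize aRaise l (bsFinite lam l u) = w at *
  have hI : Complex.I * Complex.I = -1 := Complex.I_mul_I
  -- `a_l†` is the difference of the two eigenvectors divided by `2i`.
  have h3 : y = (-Complex.I / 2 : ℂ) • ((x + Complex.I • y) - (x + (-Complex.I) • y)) := by
    match_scalars
    · linear_combination hI
    · ring
  rw [h3, h1, h2]
  simp only [smul_add, smul_sub, smul_smul, add_mul, mul_add]
  match_scalars
  · linear_combination (Complex.sin θ) * hI
  · linear_combination (-(Complex.cos θ)) * hI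

/-! ### The interaction on finite vectors -/

/-- The composition of the beam splitters in the list `L`, the head acting first. -/
def bsChain {k : ℕ} (lam : ℝ) (L : List (Fin k)) : Module.End ℂ (Joint k →₀ ℂ) :=
  (L.map (bsFinite lam)).reverse.prod

theorem bsChain_cons {k : ℕ} (lam : ℝ) (l : Fin k) (L : List (Fin k)) :
    bsChain lam (l :: L) = bsChain lam L * bsFinite lam l := by
  simp [bsChain]

theorem bsChain_surjective {k : ℕ} (lam : ℝ) (L : List (Fin k)) :
    Function.Surjective (bsChain lam L) := by
  induction L with
  | nil => exact Function.surjective_id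
  | cons l L ih =>
    rw [bsChain_cons]
    exact ih.comp (bsFinite_surjective lam l)

theorem embed_bsChain {k : ℕ} (lam : ℝ) (L : List (Fin k)) (u : Joint k →₀ ℂ) :
    embed _ (bsChain lam L u) = (L.map (beamSplitter lam)).reverse.prod (embed _ u) := by
  induction L generalizing u with
  | nil => simp [bsChain]
  | cons l L ih =>
    rw [bsChain_cons, Module.End.mul_apply, ih, embed_bsFinite]
    simp

theorem embed_bsChain_finRange {k : ℕ} (lam : ℝ) (u : Joint k →₀ ℂ) :
    embed _ (bsChain lam (List.finRange k) u) = interaction k lam (embed _ u) := by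
  rw [embed_bsChain, interaction, List.ofFn_eq_map]

/-- The span of the creation operators of the signals in `s`. -/
def raiseSpan {k : ℕ} (s : Set (Fin k)) : Submodule ℂ (Module.End ℂ (Joint k →₀ ℂ)) :=
  Submodule.span ℂ (aRaise '' s)

theorem bsFinite_comm {k : ℕ} (lam : ℝ) (l : Fin k) {s : Set (Fin k)} (hl : l ∉ s)
    {A : Module.End ℂ (Joint k →₀ ℂ)} (hA : A ∈ raiseSpan s) :
    bsFinite lam l * A = A * bsFinite lam l := by
  induction hA using Submodule.span_induction with
  | zero => simp
  | add x y _ _ hx hy => rw [mul_add, add_mul, hx, hy]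
  | smul c x _ hx => rw [mul_smul_comm, smul_mul_assoc, hx]
  | mem x hx =>
    obtain ⟨l', hl', rfl⟩ := hx
    exact bsFinite_aRaise_of_ne lam (fun h => hl (h ▸ hl'))

theorem bsChain_comm {k : ℕ} (lam : ℝ) (l : Fin k) (L : List (Fin k)) (hl : l ∉ L) :
    bsChain lam L * aRaise l = aRaise l * bsChain lam L := by
  induction L with
  | nil => simp [bsChain]
  | cons l' L ih =>
    rw [List.mem_cons, not_or] at hl
    rw [bsChain_cons, mul_assoc, bsFinite_aRaise_of_ne lam (Ne.symm hl.1), ← mul_assoc, ih hl.2,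
      mul_assoc]

/-- The first beam splitter turns `b†` into `cos θ b† + sin θ a_l†`. The later ones do not involve
signal `l`, because `L` has no duplicates, so `a_l†` passes through them unchanged while `b†` gains
one more factor `cos θ` at each. -/
theorem bsChain_bRaise {k : ℕ} (lam : ℝ) (L : List (Fin k)) (hL : L.Nodup) :
    ∃ A ∈ raiseSpan {l | l ∈ L}, bsChain lam L * bRaise
      = (Complex.cos (Real.arccos (Real.sqrt lam)) ^ L.length • bRaise + A) * bsChain lam L := by
  induction L with
  | nil => exact ⟨0, zero_mem _, by simp [bsChain]⟩
  | cons l L ih =>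
    obtain ⟨hl, hL⟩ := List.nodup_cons.1 hL
    obtain ⟨A, hA, h⟩ := ih hL
    refine ⟨Complex.cos (Real.arccos (Real.sqrt lam)) • A
      + Complex.sin (Real.arccos (Real.sqrt lam)) • aRaise l, add_mem (Submodule.smul_mem _ _ ?_)
        (Submodule.smul_mem _ _ (Submodule.subset_span ⟨l, by simp, rfl⟩)), ?_⟩
    · exact Submodule.span_mono (Set.image_mono fun x hx => List.mem_cons_of_mem _ hx) hA
    · rw [bsChain_cons, mul_assoc, bsFinite_bRaise, ← mul_assoc, mul_add, mul_smul_comm, h,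
        mul_smul_comm, bsChain_comm lam l L hl, ← mul_assoc, ← smul_mul_assoc, ← smul_mul_assoc,
        ← add_mul, smul_add, smul_smul, List.length_cons, pow_succ', add_assoc]

/-- The inverse rotation, obtained from the two forward relations and `cos² θ + sin² θ = 1`. -/
theorem bRaise_bsFinite {k : ℕ} (lam : ℝ) (l : Fin k) :
    bRaise * bsFinite lam l = bsFinite lam l * (Complex.cos (Real.arccos (Real.sqrt lam)) • bRaise
      - Complex.sin (Real.arccos (Real.sqrt lam)) • aRaise l) := by
  have h := Complex.cos_sq_add_sin_sq (Real.arccos (Real.sqrt lam))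
  refine LinearMap.ext fun u => ?_
  have h1 := LinearMap.congr_fun (bsFinite_bRaise lam l) u
  have h2 := LinearMap.congr_fun (bsFinite_aRaise lam l) u
  simp only [Module.End.mul_apply, LinearMap.add_apply, LinearMap.sub_apply, LinearMap.smul_apply] at h1 h2
  simp only [Module.End.mul_apply, LinearMap.sub_apply, LinearMap.smul_apply, map_sub, map_smul, h1, h2]
  match_scalars
  · linear_combination -h
  · ring

/-- Here `b†` is moved from the output side to the input side, so it meets the last beam splitter
first. The operator `A` collected from the tail contains no `a_l†`, hence commutes with the beam
splitter of the head `l`. -/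
theorem bRaise_bsChain {k : ℕ} (lam : ℝ) (L : List (Fin k)) (hL : L.Nodup) :
    ∃ A ∈ raiseSpan {l | l ∈ L}, bRaise * bsChain lam L
      = bsChain lam L * (Complex.cos (Real.arccos (Real.sqrt lam)) ^ L.length • bRaise + A) := by
  induction L with
  | nil => exact ⟨0, zero_mem _, by simp [bsChain]⟩
  | cons l L ih =>
    obtain ⟨hl, hL⟩ := List.nodup_cons.1 hL
    obtain ⟨A, hA, h⟩ := ih hL
    have hmem : aRaise l ∈ raiseSpan {l' | l' ∈ l :: L} :=
      Submodule.subset_span ⟨l, by simp, rfl⟩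
    refine ⟨A + (-(Complex.cos (Real.arccos (Real.sqrt lam)) ^ L.length *
      Complex.sin (Real.arccos (Real.sqrt lam)))) • aRaise l,
      add_mem ?_ (Submodule.smul_mem _ _ hmem), ?_⟩
    · exact Submodule.span_mono (Set.image_mono fun x hx => List.mem_cons_of_mem _ hx) hA
    · rw [bsChain_cons, ← mul_assoc, h, mul_assoc, add_mul, smul_mul_assoc, bRaise_bsFinite,
        ← bsFinite_comm lam l (by exact hl) hA, ← mul_smul_comm, ← mul_add, ← mul_assoc]
      congr 1
      rw [List.length_cons, pow_succ]
      module

/-- Creation operators of signals do not change the photon number of the environment. -/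
theorem raiseSpan_single {k : ℕ} {s : Set (Fin k)} {A : Module.End ℂ (Joint k →₀ ℂ)}
    (hA : A ∈ raiseSpan s) (m : Fin k → ℕ) (j : ℕ) :
    A (Finsupp.single (m, j) 1) ∈ Finsupp.supported ℂ ℂ {p : Joint k | p.2 = j} := by
  induction hA using Submodule.span_induction with
  | zero => simp
  | add x y _ _ hx hy => exact add_mem hx hy
  | smul c x _ hx => exact Submodule.smul_mem _ c hx
  | mem x hx =>
    obtain ⟨l', hl', rfl⟩ := hx
    rw [aRaise, Finsupp.linearCombination_single, one_smul]
    exact Finsupp.single_mem_supported ℂ _ rfl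

/-- A vector without component in `s` is orthogonal to the finite vectors supported in `s`. -/
theorem inner_embed_eq_zero {I : Type} [DecidableEq I] {s : Set I} {u : I →₀ ℂ}
    (hu : u ∈ Finsupp.supported ℂ ℂ s) {x : NumberSpace I} (hx : ∀ i ∈ s, x i = 0) :
    ⟪embed I u, x⟫_ℂ = 0 := by
  rw [Finsupp.supported_eq_span_single] at hu
  induction hu using Submodule.span_induction with
  | zero => simp
  | add x y _ _ hx hy => rw [map_add, inner_add_left, hx, hy, add_zero]
  | smul c x _ hx => rw [map_smul, inner_smul_left, hx, mul_zero]
  | mem v hv =>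
    obtain ⟨i, hi, rfl⟩ := hv
    simp [embed_single, inner_ket, hx i hi]

theorem bRaise_mem_supported {k : ℕ} (u : Joint k →₀ ℂ) :
    bRaise u ∈ Finsupp.supported ℂ ℂ {p : Joint k | p.2 ≠ 0} := by
  induction u using Finsupp.induction_linear with
  | zero => simp
  | add u₁ u₂ h₁ h₂ => rw [map_add]; exact add_mem h₁ h₂
  | single p c =>
    rw [bRaise, Finsupp.linearCombination_single]
    exact Submodule.smul_mem _ _ (Finsupp.single_mem_supported ℂ _ (Nat.succ_ne_zero _))

theorem inner_interaction {k : ℕ} (lam : ℝ) (x y : NumberSpace (Joint k)) :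
    ⟪interaction k lam x, interaction k lam y⟫_ℂ = ⟪x, y⟫_ℂ := by
  have h : ∀ L : List (Fin k), ∀ x y, ⟪(L.map (beamSplitter lam)).reverse.prod x,
      (L.map (beamSplitter lam)).reverse.prod y⟫_ℂ = ⟪x, y⟫_ℂ := by
    intro L
    induction L with
    | nil => simp
    | cons l L ih =>
      intro x y
      simp only [List.map_cons, List.reverse_cons, List.prod_append, List.prod_singleton,
        mul_apply_eq_comp, ih]
      exact LinearIsometry.inner_map_map _ _ _
  rw [interaction, List.ofFn_eq_map]
  exact h _ x y

/-! ### Photon numbers excluded by the intertwining relations -/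

theorem cos_pow_ne_zero {lam : ℝ} (hlam0 : 0 < lam) (hlam1 : lam ≤ 1) (r : ℕ) :
    Complex.cos (Real.arccos (Real.sqrt lam)) ^ r ≠ 0 := by
  rw [cos_arccos_sqrt hlam1]
  exact pow_ne_zero _ (by exact_mod_cast (Real.sqrt_pos.2 hlam0).ne')

theorem bRaise_ket {k : ℕ} (m : Fin k → ℕ) (j : ℕ) :
    bRaise (Finsupp.single (m, j) 1) = (Real.sqrt (j + 1) : ℂ) • Finsupp.single (m, j + 1) 1 := by
  simp [bRaise]

/-- Signals cannot turn the vacuum of the environment into a Fock state with photons. -/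
theorem eq_zero_of_interaction_vacuum {k : ℕ} {lam : ℝ} (hlam0 : 0 < lam) (hlam1 : lam ≤ 1) {n : ℕ}
    {x : NumberSpace (Joint k)} (hx0 : x ≠ 0) (hx : ∀ m j, j ≠ 0 → x (m, j) = 0)
    (hn : ∀ m j, j ≠ n → interaction k lam x (m, j) = 0) : n = 0 := by
  by_contra hne
  obtain ⟨j, rfl⟩ := Nat.exists_eq_succ_of_ne_zero hne
  obtain ⟨A, hA, hW⟩ := bsChain_bRaise lam (List.finRange k) (List.nodup_finRange k)
  set c := Complex.cos (Real.arccos (Real.sqrt lam)) ^ (List.finRange k).length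
  have hc : c ≠ 0 := cos_pow_ne_zero hlam0 hlam1 _
  -- Every finite `q` is `W p`, and `(c b† + A) W p = W b† p`. Since `W` preserves inner products,
  -- the pairing is `⟨b† p, x⟩`, which vanishes because `x` has the environment in the vacuum.
  have hzero : ∀ q, ⟪embed _ ((c • bRaise + A : Module.End ℂ (Joint k →₀ ℂ)) q), interaction k lam x⟫_ℂ = 0 := by
    intro q
    obtain ⟨p, rfl⟩ := bsChain_surjective lam (List.finRange k) q
    rw [← Module.End.mul_apply, ← hW, Module.End.mul_apply, embed_bsChain_finRange, inner_interaction]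
    exact inner_embed_eq_zero (bRaise_mem_supported p) fun i hi => hx i.1 i.2 hi
  have hWx : interaction k lam x = 0 := by
    ext1
    funext p
    obtain ⟨m, j'⟩ := p
    rcases eq_or_ne j' (j + 1) with rfl | hj
    -- The `A` part of the test vector keeps `j ≠ n` environment photons and is orthogonal to `W x`;
    -- the `b†` part isolates the component `(m, j + 1)`.
    · have h := hzero (Finsupp.single (m, j) 1)
      rw [LinearMap.add_apply, map_add, inner_add_left, inner_embed_eq_zero (raiseSpan_single hA m j)
        (fun i hi => hn i.1 i.2 (by rw [show i.2 = j from hi]; omega)), add_zero, LinearMap.smul_apply,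
        bRaise_ket, map_smul, map_smul, embed_single, inner_smul_left, inner_smul_left,
        one_smul, inner_ket] at h
      have hs : (Real.sqrt (j + 1) : ℂ) ≠ 0 := by
        exact_mod_cast (Real.sqrt_pos.2 (by positivity)).ne'
      simpa [hc, hs] using h
    · exact hn m j' hj
  have h := inner_interaction lam x x
  rw [hWx, inner_zero_left] at h
  exact hx0 (inner_self_eq_zero.1 h.symm)

/-- Signals cannot turn a one-photon state of the environment into the vacuum. -/
theorem eq_zero_of_interaction_one {k : ℕ} {lam : ℝ} (hlam0 : 0 < lam) (hlam1 : lam ≤ 1)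
    {x : NumberSpace (Joint k)} (hx : ∀ m j, j ≠ 1 → x (m, j) = 0)
    (hn : ∀ m j, j ≠ 0 → interaction k lam x (m, j) = 0) : x = 0 := by
  obtain ⟨A, hA, hW⟩ := bRaise_bsChain lam (List.finRange k) (List.nodup_finRange k)
  set c := Complex.cos (Real.arccos (Real.sqrt lam)) ^ (List.finRange k).length
  have hc : c ≠ 0 := cos_pow_ne_zero hlam0 hlam1 _
  -- Applying `W` to both arguments gives `⟨b† W q, W x⟩`, which vanishes because `W x` has the
  -- environment in the vacuum.
  have hzero : ∀ q, ⟪embed _ ((c • bRaise + A : Module.End ℂ (Joint k →₀ ℂ)) q), x⟫_ℂ = 0 := by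
    intro q
    rw [← inner_interaction lam, ← embed_bsChain_finRange, ← Module.End.mul_apply, ← hW,
      Module.End.mul_apply]
    exact inner_embed_eq_zero (bRaise_mem_supported _) fun i hi => hn i.1 i.2 hi
  ext1
  funext p
  obtain ⟨m, j⟩ := p
  rcases eq_or_ne j 1 with rfl | hj
  · have h := hzero (Finsupp.single (m, 0) 1)
    rw [LinearMap.add_apply, map_add, inner_add_left, inner_embed_eq_zero (raiseSpan_single hA m 0)
      (fun i hi => hx i.1 i.2 (by rw [show i.2 = 0 from hi]; omega)), add_zero, LinearMap.smul_apply,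
      bRaise_ket, map_smul, map_smul, embed_single, inner_smul_left, inner_smul_left,
      one_smul, inner_ket] at h
    simpa [hc] using h
  · exact hx m j hj

/-! ### Necessity -/

open scoped ComplexOrder in
/-- If the output is `|n⟩⟨n|` then all vectors in the range of the joint output state have `n` photons
in the environment. -/
theorem interaction_apply_eq_zero {k n : ℕ} {lam : ℝ} {σ₀ : Op ℕ} {ρ : Op (Fin k → ℕ)}
    (hR : (tensorOp ρ σ₀).IsPositive) (h : fockState n = environmentOutput lam σ₀ ρ)
    (y : NumberSpace (Joint k)) (i : Fin k → ℕ) {j : ℕ} (hj : j ≠ n) :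
    interaction k lam (tensorOp ρ σ₀ y) (i, j) = 0 := by
  set W := interaction k lam
  set R := tensorOp ρ σ₀
  have hT : (W ∘L R ∘L ContinuousLinearMap.adjoint W).IsPositive := hR.conj_adjoint W
  have hne : fockState n ≠ 0 := by
    intro h0
    have := congrArg (fun S : Op ℕ => ⟪ket n, S (ket n)⟫_ℂ) h0
    simp [fockState, fockVector_eq_ket, norm_ket] at this
  -- A divergent partial trace would take the default value `0`, which is not a Fock state; so the
  -- series converges and can be tested on matrix elements.
  have hsum : Summable fun i : Fin k → ℕ =>
      ContinuousLinearMap.adjoint (ketTensor i).toContinuousLinearMap ∘L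
        (W ∘L R ∘L ContinuousLinearMap.adjoint W) ∘L
        (ketTensor (J := ℕ) i).toContinuousLinearMap := by
    by_contra hs
    exact hne (h.trans (tsum_eq_zero_of_not_summable hs))
  have hs := hsum.hasSum
  rw [show (∑' i : Fin k → ℕ, _) = fockState n from h.symm] at hs
  -- The `j`-th diagonal entry of `|n⟩⟨n|` is zero for `j ≠ n`, and it is a sum of nonnegative
  -- diagonal entries of `W R W†`; each of them vanishes.
  have hdiag := (hs.mapL (ContinuousLinearMap.apply ℂ _ (ket j))).mapL (innerSL ℂ (ket j))
  simp only [ContinuousLinearMap.apply_apply, innerSL_apply_apply, ContinuousLinearMap.comp_apply,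
    ContinuousLinearMap.adjoint_inner_right, LinearIsometry.coe_toContinuousLinearMap,
    ketTensor_ket] at hdiag
  rw [fockState, fockVector_eq_ket, InnerProductSpace.rankOne_apply, inner_smul_right, inner_ket (n : ℕ) (ket j), ket_apply,
    if_neg hj, zero_mul, hasSum_zero_iff_of_nonneg (fun i => ?_)] at hdiag
  · have h0 := congrFun hdiag i
    simp only [Pi.zero_apply] at h0
    rw [← ContinuousLinearMap.adjoint_inner_left] at h0
    -- `R` kills `W†|i, j⟩`, and by symmetry of `R` the component of `W R y` at `(i, j)` is `⟨R
    -- W†|i, j⟩, y⟩`.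
    have h1 := apply_eq_zero_of_inner_eq_zero hR h0
    rw [← inner_ket, ← ContinuousLinearMap.adjoint_inner_left, ← hR.inner_left_eq_inner_right, h1,
      inner_zero_left]
  · exact hT.inner_nonneg_right _

theorem tensorKet_apply_eq_zero {k : ℕ} (m : ℕ) (ψ : NumberSpace (Fin k → ℕ)) (i : Fin k → ℕ) (j : ℕ)
    (hj : j ≠ m) : tensorKet m ψ (i, j) = 0 := by
  rw [tensorKet_apply, if_neg hj]

theorem eq_zero_of_achievable {n : ℕ} {ν lam : ℝ} (hν : 0 ≤ ν) (hlam0 : 0 < lam) (hlam1 : lam ≤ 1)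
    (h : Achievable lam (thermalState ν) (fockState n)) : n = 0 ∧ ν = 0 := by
  obtain ⟨k, ρ, hρ, h⟩ := h
  have hτ := thermalState_ket hν
  have ht : ∀ m, 0 ≤ 1 / (ν + 1) * (ν / (ν + 1)) ^ m := fun m => by positivity
  have hR := isPositive_tensorOp ρ hρ.1 (thermalState ν) _ ht hτ
  obtain ⟨i₀, hi₀⟩ := hρ.exists_ne_zero
  have hW : ∀ m, 1 / (ν + 1) * (ν / (ν + 1)) ^ m ≠ 0 → ∀ i j, j ≠ n →
      interaction k lam (tensorKet m (ρ (ket i₀))) (i, j) = 0 := by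
    intro m hm i j hj
    have h1 := interaction_apply_eq_zero hR h (ket (i₀, m)) i hj
    rw [← tensorKet_ket, tensorOp_tensorKet ρ _ _ hτ, map_smul, lp.coeFn_smul, Pi.smul_apply,
      smul_eq_mul] at h1
    exact (mul_eq_zero.1 h1).resolve_left (Complex.ofReal_ne_zero.2 hm)
  have hne : ∀ m, (tensorKet m (ρ (ket i₀)) : NumberSpace (Joint k)) ≠ 0 := fun m h0 =>
    hi₀ ((tensorKet m).injective (h0.trans (map_zero _).symm))
  -- The vacuum weight `1/(ν+1)` of the thermal state is positive for every `ν ≥ 0`, whereas the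
  -- one-photon weight used below is positive only for `ν > 0`.
  have hn : n = 0 := eq_zero_of_interaction_vacuum hlam0 hlam1 (hne 0)
    (tensorKet_apply_eq_zero 0 _) (hW 0 (by positivity))
  subst hn
  refine ⟨rfl, ?_⟩
  by_contra hν0
  have hν' : 0 < ν := lt_of_le_of_ne hν (Ne.symm hν0)
  exact hne 1 (eq_zero_of_interaction_one hlam0 hlam1 (tensorKet_apply_eq_zero 1 _)
    (hW 1 (by positivity)))

/-! ### Sufficiency -/

theorem ext_ket {I : Type} [DecidableEq I] {E : Type*} [NormedAddCommGroup E] [NormedSpace ℂ E]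
    {S T : NumberSpace I →L[ℂ] E} (h : ∀ i, S (ket i) = T (ket i)) : S = T := by
  refine ContinuousLinearMap.ext fun x => ?_
  refine ((hasSum_ket x).mapL S).unique ?_
  convert! (hasSum_ket x).mapL T using 2 with i
  rw [map_smul, map_smul, h]

theorem bsGenerator_vacuum {k : ℕ} (l : Fin k) : bsGenerator l (Finsupp.single (0, 0) 1) = 0 := by
  simp [bsGenerator, aRaise, bLower, aLower, bRaise]

theorem beamSplitter_vacuum {k : ℕ} (lam : ℝ) (l : Fin k) :
    beamSplitter lam l (ket (0, 0)) = ket (0, 0) := by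
  refine (beamSplitter_ket lam l (0, 0)).unique ?_
  -- The generator annihilates the vacuum, so only the term `r = 0` of the exponential series
  -- survives.
  convert! hasSum_ite_eq 0 (ket (0, 0) : NumberSpace (Joint k)) using 2 with r
  obtain _ | r := r
  · simp [embed_single]
  · rw [pow_succ (bsGenerator l), Module.End.mul_apply, bsGenerator_vacuum]
    simp

theorem interaction_vacuum (k : ℕ) (lam : ℝ) : interaction k lam (ket (0, 0)) = ket (0, 0) := by
  have h : ∀ L : List (Fin k),
      (L.map (beamSplitter lam)).reverse.prod (ket (0, 0)) = ket (0, 0) := by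
    intro L
    induction L with
    | nil => simp
    | cons l L ih => simp [mul_apply_eq_comp, beamSplitter_vacuum, ih]
  rw [interaction, List.ofFn_eq_map]
  exact h _

theorem tensorOp_vacuum (k : ℕ) :
    tensorOp (InnerProductSpace.rankOne ℂ (ket (0 : Fin k → ℕ)) (ket 0)) (thermalState 0)
      = InnerProductSpace.rankOne ℂ (ket (0, 0)) (ket (0, 0)) := by
  refine ext_ket fun p => ?_
  obtain ⟨m, n⟩ := p
  rw [← tensorKet_ket m n, tensorOp_tensorKet _ _ _ (thermalState_ket le_rfl), tensorKet_ket,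
    InnerProductSpace.rankOne_apply, InnerProductSpace.rankOne_apply, inner_ket, inner_ket, ket_apply,
    ket_apply]
  rcases eq_or_ne m 0 with rfl | hm
  -- At `ν = 0` the thermal weights are `0 ^ n`: the convention `0 ^ 0 = 1` gives weight one to the
  -- vacuum, and all other weights vanish.
  · obtain _ | n := n
    · simp [tensorKet_ket]
    · simp
  · simp [hm]

theorem achievableWith_vacuum (k : ℕ) (lam : ℝ) :
    AchievableWith k lam (thermalState 0) (fockState 0) := by
  refine ⟨_, isState_rankOne_ket 0, ?_⟩
  have h : interaction k lam ∘L tensorOp (InnerProductSpace.rankOne ℂ (ket (0 : Fin k → ℕ)) (ket 0))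
      (thermalState 0) ∘L ContinuousLinearMap.adjoint (interaction k lam)
      = InnerProductSpace.rankOne ℂ (ket (0, 0)) (ket (0, 0)) := by
    refine ContinuousLinearMap.ext fun x => ?_
    simp only [tensorOp_vacuum, ContinuousLinearMap.comp_apply, InnerProductSpace.rankOne_apply,
      map_smul, interaction_vacuum, ContinuousLinearMap.adjoint_inner_right]
  -- Only the signal vacuum contributes to the partial trace of the joint vacuum.
  have hterm : ∀ i : Fin k → ℕ, ContinuousLinearMap.adjoint (ketTensor i).toContinuousLinearMap ∘L
      InnerProductSpace.rankOne ℂ (ket ((0 : Fin k → ℕ), 0)) (ket (0, 0)) ∘L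
        (ketTensor (J := ℕ) i).toContinuousLinearMap = if i = 0 then fockState 0 else 0 := by
    intro i
    refine ext_ket fun j => ?_
    refine lp.ext (funext fun j' => ?_)
    rw [← inner_ket]
    simp only [ContinuousLinearMap.comp_apply, ContinuousLinearMap.adjoint_inner_right,
      LinearIsometry.coe_toContinuousLinearMap, ketTensor_ket, InnerProductSpace.rankOne_apply,
      inner_smul_right, inner_ket, ket_apply]
    rcases eq_or_ne i 0 with rfl | hi
    · rw [if_pos rfl, fockState, fockVector_eq_ket, InnerProductSpace.rankOne_apply, lp.coeFn_smul,
        Pi.smul_apply, inner_ket, ket_apply, ket_apply]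
      simp
    · simp [hi]
  rw [environmentOutput, h, partialTrace, tsum_congr hterm, tsum_ite_eq]

end Bosonic

end

/-- For `λ ∈ (0, 1)` and `ν ≥ 0` the Fock state `|n⟩⟨n|` is `(λ, τ_ν)`-achievable only in the trivial case
`n = ν = 0`, and in that case it is achievable with any number of trigger signals. -/
theorem mainTheorem6 (n : ℕ) (ν : ℝ) (hν : 0 ≤ ν) (lam : ℝ) (hlam0 : 0 < lam) (hlam1 : lam < 1) :
    (Bosonic.Achievable lam (Bosonic.thermalState ν) (Bosonic.fockState n) ↔ n = 0 ∧ ν = 0) ∧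
      (n = 0 ∧ ν = 0 → ∀ k : ℕ,
        Bosonic.AchievableWith k lam (Bosonic.thermalState ν) (Bosonic.fockState n)) := by
  have h : n = 0 ∧ ν = 0 → ∀ k : ℕ,
      Bosonic.AchievableWith k lam (Bosonic.thermalState ν) (Bosonic.fockState n) := by
    rintro ⟨rfl, rfl⟩ k
    exact Bosonic.achievableWith_vacuum k lam
  -- Any number of signals serves as a witness for achievability; `k = 0` is taken.
  exact ⟨⟨Bosonic.eq_zero_of_achievable hν hlam0 hlam1.le, fun h0 => ⟨0, h h0 0⟩⟩, h⟩
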